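/- **Setting.** Systems $A,B,E,\dots$ are finite-dimensional with dimension $d_A\ge 1$ and Hilbert space $\mathcal H_A=\mathbb C^{d_A}$; every dimension occurs, and the trivial system $I$ has $d_I=1$. A string $w=A_1\dots A_n$ has $\mathcal H_w=\bigotimes_i\mathcal H_{A_i}$ (the empty string gives $\mathbb C$). *Types* are generated as follows: every string of systems is a type; for systems $X,Y$ with $d_X=d_Y$ and strings $A,B$ of systems, $\hat XA\to\hat YB$ is a (ground) type; if $x,y$ are types, so is $x\to y$. Put $\mathcal H_{\hat XA\to\hat YB}=\mathcal H_X\otimes\mathcal H_A\otimes\mathcal H_Y\otimes\mathcal H_B$, $\mathcal H_{x\to y}=\mathcal H_x\otimes\mathcal H_y$ (different occurrences of systems are different tensor factors) and $d_x=\dim\mathcal H_x$. The extension of a type by a system $E$ is $A_1\dots A_n\|E=A_1\dots A_nE$, $(\hat XA\to\hat YB)\|E=\hat XA\to\hat YBE$, $(x\to y)\|E=x\to(y\|E)$, so that $\mathcal H_{x\|E}=\mathcal H_x\otimes\mathcal H_E$. **Events.** The sets $\mathsf T_1(x)\subseteq\mathcal L(\mathcal H_x)$ of deterministic and $\mathsf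 T(x)\subseteq\mathcal L(\mathcal H_x)$ of admissible events are defined recursively. - $\mathsf T_1(A_1\dots A_n)=\{M\ge 0:\operatorname{Tr}M=1\}$ and $\mathsf T_1(\hat XA\to\hat YB)=\{M\ge 0:\operatorname{Tr}_{YB}M=\mathds 1_{XA},\ \operatorname{Tr}_{XB}M=\mathds 1_{YA}\}$ (Choi operators of $X$-$Y$ bistochastic channels); for these ground types $\mathsf T(x)=\{M: 0\le M\le N\text{ for some }N\in\mathsf T_1(x)\}$. - For $M\in\mathcal L(\mathcal H_x\otimes\mathcal H_y)$ let $\mathcal M:\mathcal L(\mathcal H_x)\to\mathcal L(\mathcal H_y)$, $\mathcal M(O)=\operatorname{Tr}_x[(O^T\otimes\mathds 1_y)M]$, be the linear map with Choi operator $M$, and let $\mathcal I_E$ be the identity map on $\mathcal L(\mathcal H_E)$. Then $M\in\mathsf T_1(x\to y)$ iff for every system $E$ both $(\mathcal M\otimes\mathcal I_E)[\mathsf T(x\|E)]\subseteq\mathsf T(y\|E)$ and $(\mathcal M\otimes\mathcal I_E)[\mathsf T_1(x\|E)]\subseteq\mathsf T_1(y\|E)$. And $M\in\mathsf T(x\to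 y)$ iff (i) $(\mathcal M\otimes\mathcal I_E)[\mathsf T(x\|E)]\subseteq\mathsf T(y\|E)$ for every $E$, and (ii) there are finitely many (possibly no) operators $N_1,\dots,N_n\in\mathcal L(\mathcal H_x\otimes\mathcal H_y)$, each satisfying (i), with $M+\sum_iN_i\in\mathsf T_1(x\to y)$. **Coefficients and subspaces.** Let $\mathsf{Hrm}(\mathcal H)$ and $\mathsf{Trl}(\mathcal H)$ be the real vector spaces of Hermitian and of traceless Hermitian operators on $\mathcal H$, and $\mathsf I_A=\mathbb R\,\mathds 1_A$. Tensor products of subspaces are over $\mathbb R$. For a subspace $\Delta_x\subseteq\mathsf{Trl}(\mathcal H_x)$ let $\overline\Delta_x$ and $\Delta_x^\perp$ be its Hilbert–Schmidt orthogonal complements in $\mathsf{Trl}(\mathcal H_x)$ and in $\mathsf{Hrm}(\mathcal H_x)$. Define recursively $$\lambda_{A_1\dots A_n}=\frac1{d_{A_1\dots A_n}},\qquad \lambda_{\hat XA\to\hat YB}=\frac1{d_Yd_B},\qquad \lambda_{x\to y}=\frac{\lambda_y}{d_x\lambda_x},$$ $$\Delta_{A_1\dots A_n}=\mathsf{Trl}(\mathcal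 H_{A_1\dots A_n}),$$ $$\Delta_{\hat XA\to\hat YB}=\big(\mathsf{Hrm}(\mathcal H_{XAY})\otimes\mathsf{Trl}(\mathcal H_B)\big)\oplus\big(\mathsf{Trl}(\mathcal H_X)\otimes\mathsf{Hrm}(\mathcal H_A)\otimes\mathsf{Trl}(\mathcal H_Y)\otimes\mathsf I_B\big),$$ $$\Delta_{x\to y}=\big(\mathsf{Hrm}(\mathcal H_x)\otimes\Delta_y\big)\oplus\big(\overline\Delta_x\otimes\Delta_y^\perp\big).$$ **Theorem (Characterization of $\mathsf T_1(x)$).** For every type $x$: $\lambda_x>0$, the sum defining $\Delta_x$ is direct, $\Delta_x\subseteq\mathsf{Trl}(\mathcal H_x)$, and for every operator $R$ on $\mathcal H_x$, $$R\in\mathsf T_1(x)\iff R\ge 0\ \text{ and }\ R=\lambda_x\mathds 1_x+X_x\ \text{ for some } X_x\in\Delta_x .$$ -/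

import Mathlib

open scoped Kronecker ComplexOrder

noncomputable section

namespace HigherOrder

/-! ### Systems, strings of systems and types -/

/-- A (finite-dimensional, non-zero) quantum system, given by its dimension `d ≥ 1`;
its Hilbert space is `ℂ^d` with its standard basis.  The trivial system `I` is `1`.  Only the
dimension of a label matters: different occurrences of labels in a type always
stand for different tensor factors. -/
abbrev Sys : Type := ℕ+

/-- Index set of the standard product basis of `H_{A₁…Aₙ} = H_{A₁} ⊗ ⋯ ⊗ H_{Aₙ}`
(the empty string is the one-dimensional space `ℂ`). -/
def StrIdx : List Sys → Type
  | [] => Unit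
  | A :: w => Fin (A : ℕ) × StrIdx w

instance StrIdx.instFintype : (w : List Sys) → Fintype (StrIdx w)
  | [] => inferInstanceAs (Fintype Unit)
  | A :: w =>
    letI := StrIdx.instFintype w
    inferInstanceAs (Fintype (Fin (A : ℕ) × StrIdx w))

instance StrIdx.instDecidableEq : (w : List Sys) → DecidableEq (StrIdx w)
  | [] => inferInstanceAs (DecidableEq Unit)
  | A :: w =>
    letI := StrIdx.instDecidableEq w
    inferInstanceAs (DecidableEq (Fin (A : ℕ) × StrIdx w))

/-- `H_{A₁…AₙE} = H_{A₁…Aₙ} ⊗ H_E`, on basis labels. -/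
def StrIdx.snocEquiv (E : Sys) : (w : List Sys) → StrIdx (w ++ [E]) ≃ StrIdx w × Fin (E : ℕ)
  | [] => Equiv.prodComm (Fin (E : ℕ)) Unit
  | A :: w =>
    ((Equiv.refl (Fin (A : ℕ))).prodCongr (StrIdx.snocEquiv E w)).trans
      (Equiv.prodAssoc (Fin (A : ℕ)) (StrIdx w) (Fin (E : ℕ))).symm

/-- The types of the hierarchy: strings `A₁…Aₙ` of systems, the types `X̂u → Ŷv` of partially
bistochastic channels (`u`, `v` strings of systems), and `x → y` for types `x`, `y`. -/
inductive Ty : Type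
  | sys (w : List Sys)
  | bist (X : Sys) (u : List Sys) (Y : Sys) (v : List Sys)
  | arr (x y : Ty)

namespace Ty

/-- In every bistochastic ground type `X̂u → Ŷv` that occurs in the type, the two hatted systems
have equal dimension. -/
def Balanced : Ty → Prop
  | sys _ => True
  | bist X _ Y _ => (X : ℕ) = (Y : ℕ)
  | arr x y => x.Balanced ∧ y.Balanced

/-- The extension `x ∥ E` of a type by a system. -/
def ext : Ty → Sys → Ty
  | sys w, E => sys (w ++ [E])
  | bist X u Y v, E => bist X u Y (v ++ [E])
  | arr x y, E => arr x (y.ext E)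

/-- Nesting depth of arrows, used only for termination. -/
def depth : Ty → ℕ
  | sys _ => 0
  | bist _ _ _ _ => 0
  | arr x y => x.depth + y.depth + 1

theorem depth_ext : (x : Ty) → (E : Sys) → (x.ext E).depth = x.depth
  | sys _, _ => rfl
  | bist _ _ _ _, _ => rfl
  | arr x y, E => by simp [ext, depth, depth_ext y E]

/-- Index set of the standard product basis of `H_x`; for `X̂u → Ŷv` the factors are in the order
`X, u, Y, v`. -/
def Idx : Ty → Type
  | sys w => StrIdx w
  | bist X u Y v => ((Fin (X : ℕ) × StrIdx u) × Fin (Y : ℕ)) × StrIdx v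
  | arr x y => x.Idx × y.Idx

instance Idx.instFintype : (x : Ty) → Fintype x.Idx
  | sys w => inferInstanceAs (Fintype (StrIdx w))
  | bist X u Y v =>
    inferInstanceAs (Fintype (((Fin (X : ℕ) × StrIdx u) × Fin (Y : ℕ)) × StrIdx v))
  | arr x y =>
    letI := Idx.instFintype x
    letI := Idx.instFintype y
    inferInstanceAs (Fintype (x.Idx × y.Idx))

instance Idx.instDecidableEq : (x : Ty) → DecidableEq x.Idx
  | sys w => inferInstanceAs (DecidableEq (StrIdx w))
  | bist X u Y v =>
    inferInstanceAs (DecidableEq (((Fin (X : ℕ) × StrIdx u) × Fin (Y : ℕ)) × StrIdx v))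
  | arr x y =>
    letI := Idx.instDecidableEq x
    letI := Idx.instDecidableEq y
    inferInstanceAs (DecidableEq (x.Idx × y.Idx))

/-- `H_{x∥E} = H_x ⊗ H_E`, on basis labels. -/
def extEquiv (E : Sys) : (x : Ty) → (x.ext E).Idx ≃ x.Idx × Fin (E : ℕ)
  | sys w => StrIdx.snocEquiv E w
  | bist X u Y v =>
    ((Equiv.refl ((Fin (X : ℕ) × StrIdx u) × Fin (Y : ℕ))).prodCongr
        (StrIdx.snocEquiv E v)).trans
      (Equiv.prodAssoc ((Fin (X : ℕ) × StrIdx u) × Fin (Y : ℕ)) (StrIdx v) (Fin (E : ℕ))).symm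
  | arr x y =>
    ((Equiv.refl x.Idx).prodCongr (extEquiv E y)).trans
      (Equiv.prodAssoc x.Idx y.Idx (Fin (E : ℕ))).symm

/-- The generalized events of type `x`: all linear operators on `H_x`. -/
abbrev Op (x : Ty) : Type := Matrix x.Idx x.Idx ℂ

/-- `d_x = dim H_x`. -/
def dim (x : Ty) : ℕ := Fintype.card x.Idx

end Ty

/-! ### Choi isomorphism and extended maps -/

section Choi

variable {m n e : Type}

/-- Choi operator `(id ⊗ 𝓜)(|1⟩⟩⟨⟨1|) = ∑ |i⟩⟨i'| ⊗ 𝓜(|i⟩⟨i'|)` of a linear map `𝓜`. -/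
def choi [DecidableEq m] (𝓜 : Matrix m m ℂ →ₗ[ℂ] Matrix n n ℂ) : Matrix (m × n) (m × n) ℂ :=
  Matrix.of fun p q => 𝓜 (Matrix.single p.1 q.1 1) p.2 q.2

/-- The linear map with Choi operator `M`: `O ↦ Tr_m [(Oᵀ ⊗ 1) M]`. -/
def unchoi [Fintype m] (M : Matrix (m × n) (m × n) ℂ) : Matrix m m ℂ →ₗ[ℂ] Matrix n n ℂ where
  toFun O := Matrix.of fun j j' => ∑ i, ∑ i', O i i' * M (i, j) (i', j')
  map_add' O O' := by
    ext j j'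
    simp [add_mul, Finset.sum_add_distrib]
  map_smul' c O := by
    ext j j'
    simp [mul_assoc, Finset.mul_sum]

theorem choi_unchoi [Fintype m] [DecidableEq m] (M : Matrix (m × n) (m × n) ℂ) :
    choi (unchoi M) = M := by
  ext ⟨i, j⟩ ⟨i', j'⟩
  simp [choi, unchoi, Matrix.single_apply, ite_and]

theorem unchoi_choi [Fintype m] [DecidableEq m] (𝓜 : Matrix m m ℂ →ₗ[ℂ] Matrix n n ℂ) :
    unchoi (choi 𝓜) = 𝓜 := by
  refine LinearMap.ext fun O => Matrix.ext fun j j' => ?_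
  conv_rhs => rw [Matrix.matrix_eq_sum_single O]
  simp only [map_sum, Matrix.sum_apply]
  refine Finset.sum_congr rfl fun i _ => Finset.sum_congr rfl fun i' _ => ?_
  have h : Matrix.single i i' (O i i') = O i i' • Matrix.single i i' (1 : ℂ) := by simp
  rw [h, map_smul]
  rfl

/-- The map `𝓜 ⊗ 𝓘_e`: apply `𝓜` to each of the blocks `⟨k| S |k'⟩` of `S`, `k, k' ∈ e`. -/
def tensorId (e : Type) (𝓜 : Matrix m m ℂ →ₗ[ℂ] Matrix n n ℂ) :
    Matrix (m × e) (m × e) ℂ →ₗ[ℂ] Matrix (n × e) (n × e) ℂ where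
  toFun S := Matrix.of fun p q => 𝓜 (Matrix.of fun i i' => S (i, p.2) (i', q.2)) p.1 q.1
  map_add' S S' := by
    ext p q
    exact congrFun (congrFun (𝓜.map_add (Matrix.of fun i i' => S (i, p.2) (i', q.2))
      (Matrix.of fun i i' => S' (i, p.2) (i', q.2))) p.1) q.1
  map_smul' c S := by
    ext p q
    exact congrFun (congrFun (𝓜.map_smul c (Matrix.of fun i i' => S (i, p.2) (i', q.2))) p.1) q.1

theorem tensorId_kronecker (𝓜 : Matrix m m ℂ →ₗ[ℂ] Matrix n n ℂ)
    (S : Matrix m m ℂ) (T : Matrix e e ℂ) : tensorId e 𝓜 (S ⊗ₖ T) = 𝓜 S ⊗ₖ T := by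
  ext p q
  have h : (Matrix.of fun i i' => S i i' * T p.2 q.2) = T p.2 q.2 • S := by
    ext i i'
    simp [mul_comm]
  simp [tensorId, h, mul_comm]

end Choi

namespace Ty

/-- For `M` of type `x → y`, Choi operator of the map `𝓜`, the map
`𝓜 ⊗ 𝓘_E : L(H_{x∥E}) → L(H_{y∥E})`. -/
def extMap {x y : Ty} (M : (arr x y).Op) (E : Sys) (S : (x.ext E).Op) : (y.ext E).Op :=
  Matrix.reindex (extEquiv E y).symm (extEquiv E y).symm
    (tensorId (Fin (E : ℕ)) (unchoi (m := x.Idx) (n := y.Idx) M)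
      (Matrix.reindex (extEquiv E x) (extEquiv E x) S))

/-- `(𝓜 ⊗ 𝓘_E)[P_E] ⊆ Q_E` for every system `E`. -/
def Preserves {x y : Ty} (P : (E : Sys) → Set (x.ext E).Op) (Q : (E : Sys) → Set (y.ext E).Op)
    (M : (arr x y).Op) : Prop :=
  ∀ E : Sys, ∀ S ∈ P E, extMap M E S ∈ Q E

end Ty

/-! ### Deterministic and admissible events -/

section Elementary

variable {X a Y b : Type} [Fintype X] [Fintype Y] [Fintype b]

/-- `Tr_{Yb}` of an operator on `X ⊗ a ⊗ Y ⊗ b`, an operator on `X ⊗ a`. -/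
def trOut (R : Matrix (((X × a) × Y) × b) (((X × a) × Y) × b) ℂ) : Matrix (X × a) (X × a) ℂ :=
  Matrix.of fun p q => ∑ j : Y, ∑ k : b, R ((p, j), k) ((q, j), k)

/-- `Tr_{Xb}` of an operator on `X ⊗ a ⊗ Y ⊗ b`, an operator on `Y ⊗ a`. -/
def trFlip (R : Matrix (((X × a) × Y) × b) (((X × a) × Y) × b) ℂ) : Matrix (Y × a) (Y × a) ℂ :=
  Matrix.of fun p q => ∑ i : X, ∑ k : b, R (((i, p.2), p.1), k) (((i, q.2), q.1), k)

end Elementary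

/-- `T₁(A₁…Aₙ)`: density operators. -/
def sysDet (w : List Sys) : Set (Ty.sys w).Op :=
  {M | M.PosSemidef ∧ M.trace = 1}

/-- `T₁(X̂u → Ŷv)`: Choi operators of channels `Xu → Yv` that are `X-Y` bistochastic. -/
def bistDet (X : Sys) (u : List Sys) (Y : Sys) (v : List Sys) : Set (Ty.bist X u Y v).Op :=
  {R | R.PosSemidef ∧
    trOut (X := Fin (X : ℕ)) (a := StrIdx u) (Y := Fin (Y : ℕ)) (b := StrIdx v) R = 1 ∧
    trFlip (X := Fin (X : ℕ)) (a := StrIdx u) (Y := Fin (Y : ℕ)) (b := StrIdx v) R = 1}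

/-- The operators `M` with `0 ≤ M ≤ N` for some `N ∈ D`. -/
def below {x : Ty} (D : Set x.Op) : Set x.Op :=
  {M | M.PosSemidef ∧ ∃ N ∈ D, (N - M).PosSemidef}

namespace Ty

/-- The pair `(T(x), T₁(x))` of the admissible and the deterministic events of type `x`. -/
def events : (x : Ty) → Set x.Op × Set x.Op
  | sys w => (below (sysDet w), sysDet w)
  | bist X u Y v => (below (bistDet X u Y v), bistDet X u Y v)
  | arr x y =>
    ({M | Preserves (fun E => (events (x.ext E)).1) (fun E => (events (y.ext E)).1) M ∧
        ∃ (n : ℕ) (N : Fin n → (arr x y).Op),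
          (∀ i, Preserves (fun E => (events (x.ext E)).1) (fun E => (events (y.ext E)).1) (N i)) ∧
          Preserves (fun E => (events (x.ext E)).1) (fun E => (events (y.ext E)).1)
            (M + ∑ i, N i) ∧
          Preserves (fun E => (events (x.ext E)).2) (fun E => (events (y.ext E)).2)
            (M + ∑ i, N i)},
     {M | Preserves (fun E => (events (x.ext E)).1) (fun E => (events (y.ext E)).1) M ∧
        Preserves (fun E => (events (x.ext E)).2) (fun E => (events (y.ext E)).2) M})
  termination_by x => x.depth
  decreasing_by all_goals simp only [depth_ext, depth]; omega

/-- `T(x)`, the admissible events of type `x`. -/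
def adm (x : Ty) : Set x.Op := x.events.1

/-- `T₁(x)`, the deterministic events of type `x`. -/
def det (x : Ty) : Set x.Op := x.events.2

end Ty

/-! ### Real subspaces of Hermitian operators -/

section Subspaces

variable {m n : Type} [Fintype m]

/-- `Hrm`: the real space of Hermitian operators. -/
def Hrm (m : Type) : Submodule ℝ (Matrix m m ℂ) where
  carrier := {A | A.IsHermitian}
  add_mem' hA hB := hA.add hB
  zero_mem' := Matrix.isHermitian_zero
  smul_mem' c A hA := by
    change (c • A).conjTranspose = c • A
    rw [Matrix.conjTranspose_smul, hA.eq, star_trivial]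

/-- The operators of trace zero. -/
def trZero (m : Type) [Fintype m] : Submodule ℝ (Matrix m m ℂ) where
  carrier := {A | A.trace = 0}
  add_mem' hA hB := by
    simp only [Set.mem_ofPred_eq] at hA hB ⊢
    rw [Matrix.trace_add, hA, hB, add_zero]
  zero_mem' := Matrix.trace_zero m ℂ
  smul_mem' c A hA := by
    simp only [Set.mem_ofPred_eq] at hA ⊢
    rw [Matrix.trace_smul, hA, smul_zero]

/-- `Trl`: the traceless Hermitian operators. -/
def Trl (m : Type) [Fintype m] : Submodule ℝ (Matrix m m ℂ) := Hrm m ⊓ trZero m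

/-- `I`: the real span of the identity operator. -/
def Idn (m : Type) [DecidableEq m] : Submodule ℝ (Matrix m m ℂ) :=
  Submodule.span ℝ {(1 : Matrix m m ℂ)}

/-- The tensor product of two real operator subspaces, as a subspace of the operators on the
product space: the real span of the `a ⊗ b`. -/
def tens (V : Submodule ℝ (Matrix m m ℂ)) (W : Submodule ℝ (Matrix n n ℂ)) :
    Submodule ℝ (Matrix (m × n) (m × n) ℂ) :=
  Submodule.span ℝ {Z | ∃ a ∈ V, ∃ b ∈ W, Z = a ⊗ₖ b}

/-- `V^⊥`: the orthogonal complement of `V` in `Hrm`, for the Hilbert–Schmidt inner product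
`Tr[a† b]`. -/
def perp (V : Submodule ℝ (Matrix m m ℂ)) : Submodule ℝ (Matrix m m ℂ) where
  carrier := {b | b ∈ Hrm m ∧ ∀ a ∈ V, (a.conjTranspose * b).trace = 0}
  add_mem' := by
    rintro b c ⟨hb, hb'⟩ ⟨hc, hc'⟩
    refine ⟨add_mem hb hc, fun a ha => ?_⟩
    rw [mul_add, Matrix.trace_add, hb' a ha, hc' a ha, add_zero]
  zero_mem' := ⟨zero_mem _, fun a _ => by simp⟩
  smul_mem' := by
    rintro r b ⟨hb, hb'⟩
    refine ⟨(Hrm m).smul_mem r hb, fun a ha => ?_⟩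
    rw [Matrix.mul_smul, Matrix.trace_smul, hb' a ha, smul_zero]

/-- The orthogonal complement of `V` in `Trl`. -/
def perpTrl (V : Submodule ℝ (Matrix m m ℂ)) : Submodule ℝ (Matrix m m ℂ) := Trl m ⊓ perp V

end Subspaces

namespace Ty

/-- The coefficient `λ_x`. -/
def lam : Ty → ℝ
  | sys w => 1 / (sys w).dim
  | bist _ _ Y v => 1 / ((Y : ℕ) * (sys v).dim)
  | arr x y => y.lam / (x.dim * x.lam)

/-- The first summand of `Δ_{X̂u→Ŷv}`: `Hrm(XuY) ⊗ Trl(v)`. -/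
def bistDelta₁ (X : Sys) (u : List Sys) (Y : Sys) (v : List Sys) :
    Submodule ℝ (bist X u Y v).Op :=
  tens (Hrm ((Fin (X : ℕ) × StrIdx u) × Fin (Y : ℕ))) (Trl (StrIdx v))

/-- The second summand of `Δ_{X̂u→Ŷv}`: `Trl(X) ⊗ Hrm(u) ⊗ Trl(Y) ⊗ I_v`. -/
def bistDelta₂ (X : Sys) (u : List Sys) (Y : Sys) (v : List Sys) :
    Submodule ℝ (bist X u Y v).Op :=
  tens (tens (tens (Trl (Fin (X : ℕ))) (Hrm (StrIdx u))) (Trl (Fin (Y : ℕ)))) (Idn (StrIdx v))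

/-- The subspace `Δ_x`. -/
def Delta : (x : Ty) → Submodule ℝ x.Op
  | sys w => Trl (StrIdx w)
  | bist X u Y v => bistDelta₁ X u Y v ⊔ bistDelta₂ X u Y v
  | arr x y => tens (Hrm x.Idx) y.Delta ⊔ tens (perpTrl x.Delta) (perp y.Delta)

/-- The sum that defines `Δ_x` is direct. -/
def DeltaDirect : Ty → Prop
  | sys _ => True
  | bist X u Y v => Disjoint (bistDelta₁ X u Y v) (bistDelta₂ X u Y v)
  | arr x y => Disjoint (tens (Hrm x.Idx) y.Delta) (tens (perpTrl x.Delta) (perp y.Delta))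

end Ty

end HigherOrder

end

/-! The proof is an induction on the nesting depth of arrows, for a statement that includes the
admissible events (`Characterized`): the deterministic events are the positive elements of the
affine space `λ_x 1 + Δ_x`, and the admissible ones are the positive operators below a deterministic
one. Extension by a system keeps the depth, so at `x → y` the hypothesis is available for all `x ∥
E` and `y ∥ E`.

Three facts carry the arrow step. Positivity: `λ_x 1` is interior to the positive cone, so a small
multiple of the maximally entangled operator is admissible; a map that preserves admissibility
therefore has a positive Choi operator (`posSemidef_of_preserves_adm`). Conversely, positivity
together with preservation of deterministic events yields preservation of admissible ones
(`preserves_adm_of_le`). Linear algebra: `Δ_{x→y}` consists of the Hermitian Choi operators of maps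
that send `1` and `Δ_x` into `Δ_y` (`mem_Delta_arr`). The value of `λ_{x→y}` turns this into the
condition that `λ_x 1 + Δ_x` is sent into `λ_y 1 + Δ_y` (`mem_aff_arr`). Extension: a Hermitian
operator lies in `Δ_{x∥E}` exactly when its partial trace over `E` lies in `Δ_x` (`mem_Delta_ext`),
so the affine condition for all `E` reduces to the one without `E`. -/

noncomputable section

namespace HigherOrder

/-! ### Hermitian operators, Hilbert–Schmidt complements and the positive cone. -/

section HermitianSpaces

variable {m n : Type}

theorem mem_Hrm {A : Matrix m m ℂ} : A ∈ Hrm m ↔ A.IsHermitian := Iff.rfl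

theorem mem_Trl [Fintype m] {A : Matrix m m ℂ} : A ∈ Trl m ↔ A.IsHermitian ∧ A.trace = 0 := Iff.rfl

theorem one_mem_Hrm [DecidableEq m] : (1 : Matrix m m ℂ) ∈ Hrm m := Matrix.isHermitian_one

theorem Trl_le_Hrm [Fintype m] : Trl m ≤ Hrm m := inf_le_left

theorem perp_le_Hrm [Fintype m] (V : Submodule ℝ (Matrix m m ℂ)) : perp V ≤ Hrm m :=
  fun _ h => h.1

theorem kronecker_mem_Hrm {a : Matrix m m ℂ} {b : Matrix n n ℂ} (ha : a ∈ Hrm m)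
    (hb : b ∈ Hrm n) : a ⊗ₖ b ∈ Hrm (m × n) := by
  rw [mem_Hrm] at *
  rw [Matrix.IsHermitian, Matrix.conjTranspose_kronecker, ha.eq, hb.eq]

theorem transpose_mem_Hrm {A : Matrix m m ℂ} (hA : A ∈ Hrm m) : A.transpose ∈ Hrm m :=
  Matrix.IsHermitian.transpose hA

theorem smul_one_mem_Hrm [DecidableEq m] (c : ℝ) : c • (1 : Matrix m m ℂ) ∈ Hrm m :=
  (Hrm m).smul_mem c one_mem_Hrm

/-- The trace of a product of Hermitian operators is real. -/
theorem trace_mul_eq_ofReal [Fintype m] {A B : Matrix m m ℂ} (hA : A ∈ Hrm m) (hB : B ∈ Hrm m) :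
    (A * B).trace = (((A * B).trace.re : ℝ) : ℂ) := by
  refine (Complex.conj_eq_iff_re.1 ?_).symm
  have h := Matrix.trace_conjTranspose (A * B)
  rw [Matrix.conjTranspose_mul, mem_Hrm.1 hA |>.eq, mem_Hrm.1 hB |>.eq, Matrix.trace_mul_comm] at h
  exact h.symm

theorem trace_eq_ofReal [Fintype m] {A : Matrix m m ℂ} (hA : A ∈ Hrm m) :
    A.trace = ((A.trace.re : ℝ) : ℂ) := by
  classical
  simpa using trace_mul_eq_ofReal hA one_mem_Hrm

/-- The real part of the Hilbert–Schmidt inner product. -/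
def hsForm (m : Type) [Fintype m] : LinearMap.BilinForm ℝ (Matrix m m ℂ) :=
  LinearMap.mk₂ ℝ (fun a b => (a.conjTranspose * b).trace.re)
    (fun a b c => by simp [Matrix.conjTranspose_add, add_mul])
    (fun r a b => by simp)
    (fun a b c => by simp [mul_add])
    (fun r a b => by simp)

theorem hsForm_apply [Fintype m] (a b : Matrix m m ℂ) :
    hsForm m a b = (a.conjTranspose * b).trace.re := rfl

theorem hsForm_comm [Fintype m] (a b : Matrix m m ℂ) : hsForm m a b = hsForm m b a := by
  rw [hsForm_apply, hsForm_apply, ← Complex.conj_re]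
  congr 1
  have h := Matrix.trace_conjTranspose (a.conjTranspose * b)
  rw [Matrix.conjTranspose_mul, Matrix.conjTranspose_conjTranspose] at h
  exact h.symm

theorem eq_zero_of_hsForm_self [Fintype m] {a : Matrix m m ℂ} (h : hsForm m a a = 0) : a = 0 := by
  rw [← Matrix.trace_conjTranspose_mul_self_eq_zero_iff]
  have h0 : (0 : ℂ) ≤ (a.conjTranspose * a).trace :=
    (Matrix.posSemidef_conjTranspose_mul_self a).trace_nonneg
  exact Complex.ext h (Complex.le_def.1 h0).2.symm

theorem disjoint_perp [Fintype m] (V : Submodule ℝ (Matrix m m ℂ)) : Disjoint V (perp V) := by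
  rw [Submodule.disjoint_def]
  intro a ha ha'
  exact Matrix.trace_conjTranspose_mul_self_eq_zero_iff.1 (ha'.2 a ha)

/-- The form `hsForm` is positive definite, hence nondegenerate on `V`. For Hermitian operators its
real part is the whole inner product, so orthogonality for `hsForm` agrees with `perp`. -/
theorem Hrm_le_sup_perp [Fintype m] {V : Submodule ℝ (Matrix m m ℂ)} (hV : V ≤ Hrm m) :
    Hrm m ≤ V ⊔ perp V := by
  have hrefl : (hsForm m).IsRefl := fun a b h => by rw [hsForm_comm]; exact h
  have hc : IsCompl V ((hsForm m).orthogonal V) := by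
    refine LinearMap.BilinForm.isCompl_orthogonal_of_restrict_nondegenerate hrefl ⟨?_, ?_⟩
    · intro a ha
      exact Subtype.ext (eq_zero_of_hsForm_self (ha a))
    · intro a ha
      exact Subtype.ext (eq_zero_of_hsForm_self (ha a))
  intro A hA
  have hA' : A ∈ V ⊔ (hsForm m).orthogonal V := by rw [hc.sup_eq_top]; trivial
  obtain ⟨v, hv, w, hw, rfl⟩ := Submodule.mem_sup.1 hA'
  have hwH : w ∈ Hrm m := by simpa using sub_mem hA (hV hv)
  refine Submodule.mem_sup.2 ⟨v, hv, w, ⟨hwH, fun a ha => ?_⟩, rfl⟩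
  have h0 : (a.conjTranspose * w).trace.re = 0 := hw a ha
  rw [(mem_Hrm.1 (hV ha)).eq] at h0 ⊢
  rw [trace_mul_eq_ofReal (hV ha) hwH, h0, Complex.ofReal_zero]

theorem transpose_mem_perp [Fintype m] {V : Submodule ℝ (Matrix m m ℂ)}
    (hV : ∀ a ∈ V, a.transpose ∈ V) {b : Matrix m m ℂ} (hb : b ∈ perp V) :
    b.transpose ∈ perp V := by
  refine ⟨transpose_mem_Hrm hb.1, fun a ha => ?_⟩
  have h := hb.2 _ (hV a ha)
  rw [← Matrix.trace_transpose, Matrix.transpose_mul, Matrix.transpose_transpose,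
    Matrix.trace_mul_comm]
  exact h

theorem transpose_mem_Trl [Fintype m] {a : Matrix m m ℂ} (ha : a ∈ Trl m) :
    a.transpose ∈ Trl m :=
  ⟨transpose_mem_Hrm ha.1, (Matrix.trace_transpose a).trans ha.2⟩

theorem exists_smul_one_sub_posSemidef [Fintype m] [DecidableEq m] {A : Matrix m m ℂ}
    (hA : A ∈ Hrm m) : ∃ c : ℝ, (c • (1 : Matrix m m ℂ) - A).PosSemidef := by
  open scoped MatrixOrder Matrix.Norms.L2Operator in
  refine ⟨‖A‖, ?_⟩
  have h := IsSelfAdjoint.le_algebraMap_norm_self (show IsSelfAdjoint A from hA)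
  rwa [Matrix.le_iff, Algebra.algebraMap_eq_smul_one] at h

/-- A positive multiple of the identity is an interior point of the positive cone. -/
theorem exists_pos_smul_one_sub_smul_posSemidef [Fintype m] [DecidableEq m] {A : Matrix m m ℂ}
    (hA : A ∈ Hrm m) {l : ℝ} (hl : 0 < l) :
    ∃ ε : ℝ, 0 < ε ∧ (l • (1 : Matrix m m ℂ) - ε • A).PosSemidef := by
  obtain ⟨c, hc⟩ := exists_smul_one_sub_posSemidef hA
  have h1 : ∀ r : ℝ, 0 ≤ r → (r • (1 : Matrix m m ℂ)).PosSemidef := fun r hr =>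
    Matrix.PosSemidef.one.smul hr
  have hd : 0 < |c| + 1 := by positivity
  -- With `ε = l / (|c| + 1)`, one has `l 1 - ε A = ε (c 1 - A) + ε (|c| + 1 - c) 1`, a sum of
  -- positive operators.
  refine ⟨l / (|c| + 1), by positivity, ?_⟩
  have h2 := (hc.smul (div_pos hl hd).le).add
    (h1 (l / (|c| + 1) * (|c| + 1 - c))
      (mul_nonneg (div_pos hl hd).le (by linarith [le_abs_self c])))
  convert h2 using 1
  rw [smul_sub, smul_smul, sub_add_eq_add_sub, ← add_smul]
  congr 2
  field_simp
  ring

end HermitianSpaces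

/-! ### Real tensor products of operator subspaces. -/

section Tens

variable {m n : Type}

theorem kronecker_mem_tens {V : Submodule ℝ (Matrix m m ℂ)} {W : Submodule ℝ (Matrix n n ℂ)}
    {a : Matrix m m ℂ} {b : Matrix n n ℂ} (ha : a ∈ V) (hb : b ∈ W) : a ⊗ₖ b ∈ tens V W :=
  Submodule.subset_span ⟨a, ha, b, hb, rfl⟩

theorem tens_le {V : Submodule ℝ (Matrix m m ℂ)} {W : Submodule ℝ (Matrix n n ℂ)}
    {S : Submodule ℝ (Matrix (m × n) (m × n) ℂ)} :
    tens V W ≤ S ↔ ∀ a ∈ V, ∀ b ∈ W, a ⊗ₖ b ∈ S := by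
  refine ⟨fun h a ha b hb => h (kronecker_mem_tens ha hb), fun h => ?_⟩
  refine Submodule.span_le.2 ?_
  rintro _ ⟨a, ha, b, hb, rfl⟩
  exact h a ha b hb

/-- A real linear map sends a tensor product of subspaces into `S` as soon as it does so for the
product operators. -/
theorem map_mem_of_mem_tens {V : Submodule ℝ (Matrix m m ℂ)} {W : Submodule ℝ (Matrix n n ℂ)}
    {F : Type*} [AddCommGroup F] [Module ℝ F] {S : Submodule ℝ F}
    (L : Matrix (m × n) (m × n) ℂ →ₗ[ℝ] F) (h : ∀ a ∈ V, ∀ b ∈ W, L (a ⊗ₖ b) ∈ S)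
    {Z : Matrix (m × n) (m × n) ℂ} (hZ : Z ∈ tens V W) : L Z ∈ S :=
  tens_le (S := S.comap L) |>.2 h hZ

theorem tens_mono {V V' : Submodule ℝ (Matrix m m ℂ)} {W W' : Submodule ℝ (Matrix n n ℂ)}
    (hV : V ≤ V') (hW : W ≤ W') : tens V W ≤ tens V' W' :=
  tens_le.2 fun _ ha _ hb => kronecker_mem_tens (hV ha) (hW hb)

theorem tens_le_Hrm {V : Submodule ℝ (Matrix m m ℂ)} {W : Submodule ℝ (Matrix n n ℂ)}
    (hV : V ≤ Hrm m) (hW : W ≤ Hrm n) : tens V W ≤ Hrm (m × n) :=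
  tens_le.2 fun _ ha _ hb => kronecker_mem_Hrm (hV ha) (hW hb)

theorem tens_sup_right_le (V : Submodule ℝ (Matrix m m ℂ)) (W W' : Submodule ℝ (Matrix n n ℂ)) :
    tens V (W ⊔ W') ≤ tens V W ⊔ tens V W' := by
  refine tens_le.2 fun a ha b hb => ?_
  obtain ⟨w, hw, w', hw', rfl⟩ := Submodule.mem_sup.1 hb
  rw [Matrix.kronecker_add]
  exact Submodule.add_mem_sup (kronecker_mem_tens ha hw) (kronecker_mem_tens ha hw')

theorem tens_sup_left_le (V V' : Submodule ℝ (Matrix m m ℂ)) (W : Submodule ℝ (Matrix n n ℂ)) :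
    tens (V ⊔ V') W ≤ tens V W ⊔ tens V' W := by
  refine tens_le.2 fun a ha b hb => ?_
  obtain ⟨w, hw, w', hw', rfl⟩ := Submodule.mem_sup.1 ha
  rw [Matrix.add_kronecker]
  exact Submodule.add_mem_sup (kronecker_mem_tens hw hb) (kronecker_mem_tens hw' hb)

theorem transpose_mem_tens {V : Submodule ℝ (Matrix m m ℂ)} {W : Submodule ℝ (Matrix n n ℂ)}
    (hV : ∀ a ∈ V, a.transpose ∈ V) (hW : ∀ b ∈ W, b.transpose ∈ W)
    {Z : Matrix (m × n) (m × n) ℂ} (hZ : Z ∈ tens V W) : Z.transpose ∈ tens V W := by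
  refine map_mem_of_mem_tens
    (Matrix.transposeLinearEquiv (m × n) (m × n) ℝ ℂ).toLinearMap (fun a ha b hb => ?_) hZ
  exact kronecker_mem_tens (hV a ha) (hW b hb)

theorem transpose_mem_sup {V W : Submodule ℝ (Matrix m m ℂ)}
    (hV : ∀ a ∈ V, a.transpose ∈ V) (hW : ∀ b ∈ W, b.transpose ∈ W)
    {Z : Matrix m m ℂ} (hZ : Z ∈ V ⊔ W) : Z.transpose ∈ V ⊔ W := by
  obtain ⟨v, hv, w, hw, rfl⟩ := Submodule.mem_sup.1 hZ
  rw [Matrix.transpose_add]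
  exact Submodule.add_mem_sup (hV v hv) (hW w hw)

/-- The Hermitian part of a product operator is a real combination of products of Hermitian
operators. -/
theorem kronecker_add_conjTranspose_mem_tens (a : Matrix m m ℂ) (b : Matrix n n ℂ) :
    a ⊗ₖ b + (a ⊗ₖ b).conjTranspose ∈ tens (Hrm m) (Hrm n) := by
  have h1 : ∀ {k : Type} (c : Matrix k k ℂ), c + c.conjTranspose ∈ Hrm k := fun c => by
    rw [mem_Hrm, Matrix.IsHermitian, Matrix.conjTranspose_add,
      Matrix.conjTranspose_conjTranspose, add_comm]
  have h2 : ∀ {k : Type} (c : Matrix k k ℂ), Complex.I • (c - c.conjTranspose) ∈ Hrm k :=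
    fun c => by
    rw [mem_Hrm, Matrix.IsHermitian, Matrix.conjTranspose_smul, Matrix.conjTranspose_sub,
      Matrix.conjTranspose_conjTranspose, Complex.star_def, Complex.conj_I, neg_smul,
      ← smul_neg, neg_sub]
  -- The identity is `a ⊗ b + a† ⊗ b† = ½ (a + a†) ⊗ (b + b†) - ½ i(a - a†) ⊗ i(b - b†)`.
  have h := sub_mem
    ((tens (Hrm m) (Hrm n)).smul_mem (1 / 2 : ℝ) (kronecker_mem_tens (h1 a) (h1 b)))
    ((tens (Hrm m) (Hrm n)).smul_mem (1 / 2 : ℝ) (kronecker_mem_tens (h2 a) (h2 b)))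
  convert h using 1
  ext p q
  simp only [Matrix.add_apply, Matrix.sub_apply, Matrix.smul_apply, Matrix.kroneckerMap_apply,
    Matrix.conjTranspose_apply, star_mul', Complex.real_smul, smul_eq_mul]
  push_cast
  linear_combination (norm := ring_nf) (-1 / 2 : ℂ) * (a p.1 q.1 - star (a q.1 p.1)) *
    (b p.2 q.2 - star (b q.2 p.2)) * Complex.I_sq
  simp

theorem tens_Hrm_Hrm [Fintype m] [Fintype n] : tens (Hrm m) (Hrm n) = Hrm (m × n) := by
  classical
  refine le_antisymm (tens_le_Hrm le_rfl le_rfl) fun N hN => ?_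
  -- Matrix units of the product space are product operators, so `Z + Z†` is a sum of Hermitian
  -- parts of products; then `N = ½ (N + N†)`.
  have h : ∀ Z : Matrix (m × n) (m × n) ℂ, Z + Z.conjTranspose ∈ tens (Hrm m) (Hrm n) := by
    intro Z
    rw [Matrix.matrix_eq_sum_single Z]
    simp only [Matrix.conjTranspose_sum, ← Finset.sum_add_distrib]
    refine sum_mem fun p _ => sum_mem fun q _ => ?_
    have hk : Matrix.single p q (Z p q) =
        Matrix.single p.1 q.1 (Z p q) ⊗ₖ Matrix.single p.2 q.2 (1 : ℂ) := by
      rw [Matrix.single_kronecker_single, mul_one]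
    rw [hk]
    exact kronecker_add_conjTranspose_mem_tens _ _
  have h2 := (tens (Hrm m) (Hrm n)).smul_mem (1 / 2 : ℝ) (h N)
  rw [(mem_Hrm.1 hN).eq, ← two_smul ℝ N, smul_smul] at h2
  simpa using h2

end Tens

/-! ### Choi operators of maps between subspaces. -/

section Unchoi

variable {m n : Type} [Fintype m]

theorem unchoi_apply (N : Matrix (m × n) (m × n) ℂ) (O : Matrix m m ℂ) (j j' : n) :
    unchoi N O j j' = ∑ i, ∑ i', O i i' * N (i, j) (i', j') := rfl

theorem unchoi_add (N N' : Matrix (m × n) (m × n) ℂ) (O : Matrix m m ℂ) :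
    unchoi (N + N') O = unchoi N O + unchoi N' O := by
  ext j j'
  simp [unchoi_apply, mul_add, Finset.sum_add_distrib]

theorem unchoi_real_smul (c : ℝ) (N : Matrix (m × n) (m × n) ℂ) (O : Matrix m m ℂ) :
    unchoi (c • N) O = c • unchoi N O := by
  ext j j'
  simp only [unchoi_apply, Matrix.smul_apply, Finset.smul_sum, mul_smul_comm]

/-- The real linear dependence of `𝓝(O)` on the Choi operator `N`. -/
def unchoiAt (n : Type) (O : Matrix m m ℂ) :
    Matrix (m × n) (m × n) ℂ →ₗ[ℝ] Matrix n n ℂ where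
  toFun N := unchoi N O
  map_add' N N' := unchoi_add N N' O
  map_smul' c N := unchoi_real_smul c N O

/-- The transpose of the input comes from the Choi convention; because of it the spaces `Δ_x` must
be shown invariant under transposition. -/
theorem unchoi_kronecker (a : Matrix m m ℂ) (b : Matrix n n ℂ) (O : Matrix m m ℂ) :
    unchoi (a ⊗ₖ b) O = (O.transpose * a).trace • b := by
  ext j j'
  simp only [unchoi_apply, Matrix.kroneckerMap_apply, Matrix.smul_apply, Matrix.trace,
    Matrix.diag_apply, Matrix.mul_apply, Matrix.transpose_apply, smul_eq_mul, Finset.sum_mul]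
  rw [Finset.sum_comm]
  simp only [mul_assoc]

theorem unchoi_kronecker_mem {W : Submodule ℝ (Matrix n n ℂ)} {a O : Matrix m m ℂ}
    {b : Matrix n n ℂ} (ha : a ∈ Hrm m) (hO : O ∈ Hrm m) (hb : b ∈ W) :
    unchoi (a ⊗ₖ b) O ∈ W := by
  rw [unchoi_kronecker, trace_mul_eq_ofReal (transpose_mem_Hrm hO) ha, Complex.coe_smul]
  exact W.smul_mem _ hb

theorem unchoi_mem_of_mem_tens {W : Submodule ℝ (Matrix n n ℂ)} {V : Submodule ℝ (Matrix m m ℂ)}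
    (hV : V ≤ Hrm m) {O : Matrix m m ℂ} (hO : O ∈ Hrm m) {N : Matrix (m × n) (m × n) ℂ}
    (hN : N ∈ tens V W) : unchoi N O ∈ W :=
  map_mem_of_mem_tens (unchoiAt n O) (fun _ ha _ hb => unchoi_kronecker_mem (hV ha) hO hb) hN

theorem unchoi_eq_zero_of_mem_tens {W : Submodule ℝ (Matrix n n ℂ)}
    {V : Submodule ℝ (Matrix m m ℂ)} {O : Matrix m m ℂ}
    (hO : ∀ a ∈ V, (O.transpose * a).trace = 0) {N : Matrix (m × n) (m × n) ℂ}
    (hN : N ∈ tens V W) : unchoi N O = 0 := by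
  have h := map_mem_of_mem_tens (S := ⊥) (unchoiAt n O) (fun a ha b _ => ?_) hN
  · exact h
  · change unchoi (a ⊗ₖ b) O = 0
    rw [unchoi_kronecker, hO a ha, zero_smul]

theorem unchoi_isHermitian [Fintype n] {N : Matrix (m × n) (m × n) ℂ} (hN : N.IsHermitian)
    {O : Matrix m m ℂ} (hO : O.IsHermitian) : (unchoi N O).IsHermitian := by
  have hN' : N ∈ tens (Hrm m) (Hrm n) := by rw [tens_Hrm_Hrm]; exact hN
  exact unchoi_mem_of_mem_tens le_rfl hO hN'

/-- A map that vanishes on the Hermitian operators is zero. -/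
theorem eq_zero_of_unchoi_eq_zero {N : Matrix (m × n) (m × n) ℂ}
    (h : ∀ O ∈ Hrm m, unchoi N O = 0) : N = 0 := by
  classical
  have h0 : unchoi N = 0 := by
    refine LinearMap.ext fun O => ?_
    have h1 : O + O.conjTranspose ∈ Hrm m := by
      rw [mem_Hrm, Matrix.IsHermitian, Matrix.conjTranspose_add,
        Matrix.conjTranspose_conjTranspose, add_comm]
    have h2 : Complex.I • (O - O.conjTranspose) ∈ Hrm m := by
      rw [mem_Hrm, Matrix.IsHermitian, Matrix.conjTranspose_smul, Matrix.conjTranspose_sub,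
        Matrix.conjTranspose_conjTranspose, Complex.star_def, Complex.conj_I, neg_smul,
        ← smul_neg, neg_sub]
    have e1 := h _ h1
    have e2 := h _ h2
    rw [map_smul, smul_eq_zero_iff_right Complex.I_ne_zero, map_sub, sub_eq_zero] at e2
    rw [map_add, ← e2, ← two_smul ℂ, smul_eq_zero_iff_right two_ne_zero] at e1
    simpa using e1
  rw [← choi_unchoi N, h0]
  rfl

/-- For an operator in both spaces, every Hermitian input has its image in `W ⊓ W' = 0`. This gives
directness of the sums defining `Δ_x`. -/
theorem disjoint_tens_of_disjoint_right {V V' : Submodule ℝ (Matrix m m ℂ)}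
    {W W' : Submodule ℝ (Matrix n n ℂ)} (hV : V ≤ Hrm m) (hV' : V' ≤ Hrm m)
    (h : Disjoint W W') : Disjoint (tens V W) (tens V' W') := by
  rw [Submodule.disjoint_def] at *
  intro N hN hN'
  exact eq_zero_of_unchoi_eq_zero fun O hO =>
    h _ (unchoi_mem_of_mem_tens hV hO hN) (unchoi_mem_of_mem_tens hV' hO hN')

variable [Fintype n]

/-- Choi operators of the maps that send a subspace `U` into `W`. -/
theorem mem_tens_sup_tens_perp_iff {U : Submodule ℝ (Matrix m m ℂ)}
    {W : Submodule ℝ (Matrix n n ℂ)} (hU : U ≤ Hrm m) (hUt : ∀ a ∈ U, a.transpose ∈ U)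
    (hW : W ≤ Hrm n) {N : Matrix (m × n) (m × n) ℂ} :
    N ∈ tens (Hrm m) W ⊔ tens (perp U) (perp W) ↔
      N ∈ Hrm (m × n) ∧ ∀ D ∈ U, unchoi N D ∈ W := by
  have key : ∀ D ∈ U, ∀ a ∈ perp U, (D.transpose * a).trace = 0 := by
    intro D hD a ha
    have h := ha.2 _ (hUt D hD)
    rwa [mem_Hrm.1 (hU (hUt D hD)) |>.eq] at h
  constructor
  · intro h
    refine ⟨sup_le (tens_le_Hrm le_rfl hW)
      (tens_le_Hrm (perp_le_Hrm U) (perp_le_Hrm W)) h, fun D hD => ?_⟩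
    obtain ⟨N₁, h₁, N₂, h₂, rfl⟩ := Submodule.mem_sup.1 h
    rw [unchoi_add, unchoi_eq_zero_of_mem_tens (key D hD) h₂, add_zero]
    exact unchoi_mem_of_mem_tens le_rfl (hU hD) h₁
  · rintro ⟨hN, h⟩
    rw [← tens_Hrm_Hrm] at hN
    -- Splitting the output along `W` and `perp W`, then the input of the second piece along `U` and
    -- `perp U`, leaves one unwanted piece `N₃` in `U ⊗ perp W`.
    have hN' := tens_sup_right_le _ _ _ (tens_mono le_rfl (Hrm_le_sup_perp hW) hN)
    obtain ⟨N₁, h₁, N₂, h₂, rfl⟩ := Submodule.mem_sup.1 hN'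
    have h₂' := tens_sup_left_le _ _ _ (tens_mono (Hrm_le_sup_perp hU) le_rfl h₂)
    obtain ⟨N₃, h₃, N₄, h₄, rfl⟩ := Submodule.mem_sup.1 h₂'
    -- `N₃` kills `perp U`, and on `U` its values lie in `perp W` by construction and in `W` by
    -- hypothesis.
    have hz : N₃ = 0 := by
      refine eq_zero_of_unchoi_eq_zero fun O hO => ?_
      obtain ⟨D, hD, C, hC, rfl⟩ := Submodule.mem_sup.1 (Hrm_le_sup_perp hU hO)
      have hC0 : unchoi N₃ C = 0 := by
        refine unchoi_eq_zero_of_mem_tens (fun a ha => ?_) h₃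
        rw [← Matrix.trace_transpose, Matrix.transpose_mul, Matrix.transpose_transpose]
        exact key a ha C hC
      have hD0 : unchoi N₃ D = 0 := by
        refine Submodule.disjoint_def.1 (disjoint_perp W) _ ?_
          (unchoi_mem_of_mem_tens hU (hU hD) h₃)
        have h5 := h D hD
        rw [unchoi_add, unchoi_add, unchoi_eq_zero_of_mem_tens (key D hD) h₄, add_zero] at h5
        exact (Submodule.add_mem_iff_right _
          (unchoi_mem_of_mem_tens le_rfl (hU hD) h₁)).1 h5
      rw [map_add, hC0, hD0, add_zero]
    rw [hz, zero_add]
    exact Submodule.add_mem_sup h₁ h₄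

/-- Orthogonality to `1` is tracelessness. Hence `perpTrl` is an ordinary complement, and the
criterion for maps `U → W` applies with `U = Idn m ⊔ V`. -/
theorem perp_Idn_sup [DecidableEq m] (V : Submodule ℝ (Matrix m m ℂ)) :
    perp (Idn m ⊔ V) = perpTrl V := by
  refine le_antisymm (fun b hb => ?_) (fun b hb => ?_)
  · have h1 := hb.2 1 (Submodule.mem_sup_left (Submodule.mem_span_singleton_self 1))
    rw [Matrix.conjTranspose_one, one_mul] at h1
    exact ⟨⟨hb.1, h1⟩, hb.1, fun a ha => hb.2 a (Submodule.mem_sup_right ha)⟩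
  · refine ⟨hb.1.1, fun a ha => ?_⟩
    obtain ⟨c, hc, v, hv, rfl⟩ := Submodule.mem_sup.1 ha
    obtain ⟨r, rfl⟩ := Submodule.mem_span_singleton.1 hc
    have h1 : b.trace = 0 := hb.1.2
    rw [Matrix.conjTranspose_add, add_mul, Matrix.trace_add, hb.2.2 v hv, add_zero,
      Matrix.conjTranspose_smul, Matrix.conjTranspose_one, Matrix.smul_mul, one_mul,
      Matrix.trace_smul, h1, smul_zero]

theorem mem_tens_sup_tens_perpTrl_iff [DecidableEq m] {V : Submodule ℝ (Matrix m m ℂ)}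
    {W : Submodule ℝ (Matrix n n ℂ)} (hV : V ≤ Hrm m) (hVt : ∀ a ∈ V, a.transpose ∈ V)
    (hW : W ≤ Hrm n) {N : Matrix (m × n) (m × n) ℂ} :
    N ∈ tens (Hrm m) W ⊔ tens (perpTrl V) (perp W) ↔
      N.IsHermitian ∧ unchoi N 1 ∈ W ∧ ∀ D ∈ V, unchoi N D ∈ W := by
  have hI : Idn m ≤ Hrm m := (Submodule.span_singleton_le_iff_mem _ _).2 one_mem_Hrm
  have hIt : ∀ a ∈ Idn m, a.transpose ∈ Idn m := by
    intro a ha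
    obtain ⟨r, rfl⟩ := Submodule.mem_span_singleton.1 ha
    rwa [Matrix.transpose_smul, Matrix.transpose_one]
  rw [← perp_Idn_sup, mem_tens_sup_tens_perp_iff (sup_le hI hV)
    (fun a ha => transpose_mem_sup hIt hVt ha) hW]
  refine and_congr_right fun _ => ⟨fun h => ⟨h 1 (Submodule.mem_sup_left
    (Submodule.mem_span_singleton_self 1)), fun D hD => h D (Submodule.mem_sup_right hD)⟩, ?_⟩
  rintro ⟨h1, hD⟩ a ha
  obtain ⟨c, hc, v, hv, rfl⟩ := Submodule.mem_sup.1 ha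
  obtain ⟨r, rfl⟩ := Submodule.mem_span_singleton.1 hc
  rw [map_add, ← Complex.coe_smul, map_smul, Complex.coe_smul]
  exact add_mem (W.smul_mem r h1) (hD v hv)

end Unchoi

/-! ### Partial trace and complete positivity. -/

section PartialTrace

variable {m n : Type} [Fintype n]

/-- The partial trace over the second factor. -/
def ptrace (N : Matrix (m × n) (m × n) ℂ) : Matrix m m ℂ :=
  Matrix.of fun i i' => ∑ k, N (i, k) (i', k)

theorem ptrace_apply (N : Matrix (m × n) (m × n) ℂ) (i i' : m) :
    ptrace N i i' = ∑ k, N (i, k) (i', k) := rfl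

/-- The partial trace as a real linear map. -/
def ptraceLin (m n : Type) [Fintype n] :
    Matrix (m × n) (m × n) ℂ →ₗ[ℝ] Matrix m m ℂ where
  toFun := ptrace
  map_add' N N' := by ext; simp [ptrace_apply, Finset.sum_add_distrib]
  map_smul' c N := by
    ext
    simp only [ptrace_apply, Matrix.smul_apply, Finset.smul_sum, RingHom.id_apply]

theorem ptrace_kronecker (a : Matrix m m ℂ) (b : Matrix n n ℂ) :
    ptrace (a ⊗ₖ b) = b.trace • a := by
  ext i i'
  simp [ptrace_apply, Matrix.trace, Finset.mul_sum, mul_comm]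

theorem ptrace_isHermitian {N : Matrix (m × n) (m × n) ℂ} (hN : N.IsHermitian) :
    (ptrace N).IsHermitian := by
  ext i i'
  simp only [Matrix.conjTranspose_apply, ptrace_apply, star_sum]
  exact Finset.sum_congr rfl fun k _ => hN.apply _ _

theorem trace_ptrace [Fintype m] (N : Matrix (m × n) (m × n) ℂ) :
    (ptrace N).trace = N.trace := by
  simp [Matrix.trace, ptrace_apply, Fintype.sum_prod_type]

theorem ptrace_tensorId {m' : Type} (𝓜 : Matrix m m ℂ →ₗ[ℂ] Matrix m' m' ℂ)
    (S : Matrix (m × n) (m × n) ℂ) : ptrace (tensorId n 𝓜 S) = 𝓜 (ptrace S) := by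
  have h : ptrace S = ∑ k, Matrix.of fun i i' => S (i, k) (i', k) := by
    ext i i'
    simp [ptrace_apply, Matrix.sum_apply]
  ext j j'
  rw [h, map_sum, Matrix.sum_apply]
  rfl

/-- The output is a compression of `S ⊗ M`: restrict to equal indices on the two copies of `m`, then
conjugate by the column of identity blocks, which sums over rows and columns in `m` independently.
-/
theorem tensorId_unchoi_posSemidef {m' : Type} [Fintype m] [Fintype m']
    {M : Matrix (m × m') (m × m') ℂ} (hM : M.PosSemidef) {S : Matrix (m × n) (m × n) ℂ}
    (hS : S.PosSemidef) : (tensorId n (unchoi M) S).PosSemidef := by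
  classical
  have h := ((hS.kronecker hM).submatrix
    (fun p : m × (m' × n) => ((p.1, p.2.2), (p.1, p.2.1)))).conjTranspose_mul_mul_same
    (Matrix.of fun (p : m × (m' × n)) (q : m' × n) => if p.2 = q then (1 : ℂ) else 0)
  refine Eq.subst (motive := Matrix.PosSemidef) ?_ h
  symm
  ext p q
  simp only [tensorId, LinearMap.coe_mk, AddHom.coe_mk, Matrix.of_apply, unchoi_apply,
    Matrix.mul_apply, Matrix.conjTranspose_apply, Fintype.sum_prod_type (α₁ := m),
    Matrix.submatrix_apply, Matrix.kroneckerMap_apply, apply_ite star, star_one, star_zero,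
    ite_mul, one_mul, zero_mul, mul_ite, mul_one, mul_zero, Finset.sum_ite_eq',
    Finset.mem_univ, if_true]
  rw [Finset.sum_comm]

end PartialTrace

/-! ### Splitting off the traceless part of a tensor factor. -/

section TracelessPart

variable {m n : Type}

/-- The traceless part of an operator of real trace. -/
def traceless [Fintype m] [DecidableEq m] (a : Matrix m m ℂ) : Matrix m m ℂ :=
  a - (Fintype.card m : ℝ)⁻¹ • a.trace • (1 : Matrix m m ℂ)

theorem traceless_mem_Trl [Fintype m] [DecidableEq m] [Nonempty m] {a : Matrix m m ℂ}
    (ha : a ∈ Hrm m) : traceless a ∈ Trl m := by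
  refine ⟨?_, ?_⟩
  · rw [traceless, trace_eq_ofReal ha, Complex.coe_smul]
    exact sub_mem ha ((Hrm m).smul_mem _ (smul_one_mem_Hrm _))
  · change (traceless a).trace = 0
    have h : (Fintype.card m : ℂ) ≠ 0 := Nat.cast_ne_zero.2 Fintype.card_ne_zero
    rw [traceless, Matrix.trace_sub, Matrix.trace_smul, Matrix.trace_smul, Matrix.trace_one,
      Complex.real_smul, smul_eq_mul]
    push_cast
    field_simp
    ring

variable [Fintype n] [DecidableEq n] [Nonempty n]

/-- An operator of `V ⊗ Hrm` minus its reduction on the first factor lies in `V ⊗ Trl`. -/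
theorem sub_ptrace_kronecker_mem_tens {V : Submodule ℝ (Matrix m m ℂ)}
    {N : Matrix (m × n) (m × n) ℂ} (hN : N ∈ tens V (Hrm n)) :
    N - (Fintype.card n : ℝ)⁻¹ • (ptrace N ⊗ₖ (1 : Matrix n n ℂ)) ∈ tens V (Trl n) := by
  let K : Matrix m m ℂ →ₗ[ℝ] Matrix (m × n) (m × n) ℂ :=
    { toFun := fun a => a ⊗ₖ (1 : Matrix n n ℂ)
      map_add' := fun a b => Matrix.add_kronecker a b 1
      map_smul' := fun r a => Matrix.smul_kronecker r a 1 }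
  refine map_mem_of_mem_tens
    (LinearMap.id - (Fintype.card n : ℝ)⁻¹ • K.comp (ptraceLin m n)) (fun a ha b hb => ?_) hN
  have h : a ⊗ₖ b - (Fintype.card n : ℝ)⁻¹ • (ptrace (a ⊗ₖ b) ⊗ₖ (1 : Matrix n n ℂ)) =
      a ⊗ₖ traceless b := by
    rw [ptrace_kronecker, traceless, Matrix.smul_kronecker, ← Matrix.kronecker_smul,
      ← Matrix.kronecker_smul]
    ext p q
    simp [Matrix.kroneckerMap_apply, mul_sub]
  change a ⊗ₖ b - (Fintype.card n : ℝ)⁻¹ • (ptrace (a ⊗ₖ b) ⊗ₖ (1 : Matrix n n ℂ)) ∈ _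
  rw [h]
  exact kronecker_mem_tens ha (traceless_mem_Trl hb)

theorem disjoint_Trl_Idn : Disjoint (Trl n) (Idn n) := by
  rw [Submodule.disjoint_def]
  intro a ha ha'
  obtain ⟨r, rfl⟩ := Submodule.mem_span_singleton.1 ha'
  have h : (r • (1 : Matrix n n ℂ)).trace = 0 := ha.2
  rw [Matrix.trace_smul, Matrix.trace_one, smul_eq_zero] at h
  rcases h with rfl | h
  · exact zero_smul _ _
  · exact absurd h (Nat.cast_ne_zero.2 Fintype.card_ne_zero)

variable [Fintype m]

/-- The splitting is `N = (N - Tr_n N ⊗ 1/d) + Tr_n N ⊗ 1/d`, with `d` the dimension of the second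
factor; the first term always lies in `Hrm ⊗ Trl`. -/
theorem mem_tens_Trl_sup_tens_Idn_iff {K : Submodule ℝ (Matrix m m ℂ)} (hK : K ≤ Hrm m)
    {N : Matrix (m × n) (m × n) ℂ} :
    N ∈ tens (Hrm m) (Trl n) ⊔ tens K (Idn n) ↔ N.IsHermitian ∧ ptrace N ∈ K := by
  have hI : Idn n ≤ Hrm n := (Submodule.span_singleton_le_iff_mem _ _).2 one_mem_Hrm
  constructor
  · intro h
    refine ⟨sup_le (tens_le_Hrm le_rfl Trl_le_Hrm) (tens_le_Hrm hK hI) h, ?_⟩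
    obtain ⟨N₁, h₁, N₂, h₂, rfl⟩ := Submodule.mem_sup.1 h
    change ptraceLin m n (N₁ + N₂) ∈ K
    rw [map_add]
    refine add_mem (map_mem_of_mem_tens _ (fun a _ b hb => ?_) h₁)
      (map_mem_of_mem_tens _ (fun a ha b hb => ?_) h₂)
    · change ptrace (a ⊗ₖ b) ∈ K
      rw [ptrace_kronecker, (mem_Trl.1 hb).2, zero_smul]
      exact zero_mem K
    · change ptrace (a ⊗ₖ b) ∈ K
      rw [ptrace_kronecker, trace_eq_ofReal (hI hb), Complex.coe_smul]
      exact K.smul_mem _ ha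
  · rintro ⟨hN, hp⟩
    have h := sub_ptrace_kronecker_mem_tens (N := N) (V := Hrm m)
      (by rw [tens_Hrm_Hrm]; exact hN)
    rw [← sub_add_cancel N ((Fintype.card n : ℝ)⁻¹ • (ptrace N ⊗ₖ (1 : Matrix n n ℂ)))]
    exact Submodule.add_mem_sup h (Submodule.smul_mem _ _
      (kronecker_mem_tens hp (Submodule.mem_span_singleton_self 1)))

end TracelessPart

/-! ### The ground space `Δ` of bistochastic channels as the kernel of two partial traces. -/

section Bistochastic

variable {X a Y b : Type} [Fintype X]

/-- The partial trace over `X` of an operator on `X ⊗ a ⊗ Y`, an operator on `Y ⊗ a`. -/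
def trFirst (K : Matrix ((X × a) × Y) ((X × a) × Y) ℂ) : Matrix (Y × a) (Y × a) ℂ :=
  Matrix.of fun p q => ∑ i : X, K ((i, p.2), p.1) ((i, q.2), q.1)

/-- `trFirst` as a real linear map. -/
def trFirstLin (X a Y : Type) [Fintype X] :
    Matrix ((X × a) × Y) ((X × a) × Y) ℂ →ₗ[ℝ] Matrix (Y × a) (Y × a) ℂ where
  toFun := trFirst
  map_add' N N' := by ext; simp [trFirst, Finset.sum_add_distrib]
  map_smul' c N := by ext; simp [trFirst, Finset.mul_sum]

theorem trFirst_kronecker (c : Matrix X X ℂ) (f : Matrix a a ℂ) (d : Matrix Y Y ℂ) :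
    trFirst ((c ⊗ₖ f) ⊗ₖ d) = c.trace • (d ⊗ₖ f) := by
  ext p q
  simp only [trFirst, Matrix.of_apply, Matrix.kroneckerMap_apply, Matrix.smul_apply,
    Matrix.trace, Matrix.diag_apply, smul_eq_mul, Finset.sum_mul]
  exact Finset.sum_congr rfl fun i _ => by ring

/-- Tensoring with `1_X / d_X` in the first position. -/
def mixFirstLin (X a Y : Type) [Fintype X] [DecidableEq X] :
    Matrix (Y × a) (Y × a) ℂ →ₗ[ℝ] Matrix ((X × a) × Y) ((X × a) × Y) ℂ where
  toFun K := (Fintype.card X : ℝ)⁻¹ • Matrix.of fun p q =>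
    (1 : Matrix X X ℂ) p.1.1 q.1.1 * K (p.2, p.1.2) (q.2, q.1.2)
  map_add' N N' := by ext; simp [mul_add]
  map_smul' c N := by
    ext
    simp only [Matrix.smul_apply, Matrix.of_apply, RingHom.id_apply, Complex.real_smul]
    ring

/-- Tensoring on the right with a fixed operator, as a real linear map. -/
def kroneckerRightLin {m n : Type} (d : Matrix n n ℂ) :
    Matrix m m ℂ →ₗ[ℝ] Matrix (m × n) (m × n) ℂ where
  toFun c := c ⊗ₖ d
  map_add' c c' := Matrix.add_kronecker c c' d
  map_smul' r c := Matrix.smul_kronecker r c d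

theorem sub_mixFirst_kronecker [DecidableEq X] (c : Matrix X X ℂ) (f : Matrix a a ℂ)
    (d : Matrix Y Y ℂ) :
    (c ⊗ₖ f) ⊗ₖ d - mixFirstLin X a Y (trFirst ((c ⊗ₖ f) ⊗ₖ d)) = (traceless c ⊗ₖ f) ⊗ₖ d := by
  rw [trFirst_kronecker]
  ext p q
  simp only [mixFirstLin, LinearMap.coe_mk, AddHom.coe_mk, traceless, Matrix.sub_apply,
    Matrix.kroneckerMap_apply, Matrix.smul_apply, Matrix.of_apply, smul_eq_mul,
    Complex.real_smul]
  ring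

variable [Fintype a] [Fintype Y]

theorem mem_tens_Trl_Hrm_Trl_iff [DecidableEq X] [Nonempty X] [DecidableEq Y] [Nonempty Y]
    {K : Matrix ((X × a) × Y) ((X × a) × Y) ℂ} :
    K ∈ tens (tens (Trl X) (Hrm a)) (Trl Y) ↔
      K.IsHermitian ∧ ptrace K = 0 ∧ trFirst K = 0 := by
  constructor
  · intro h
    refine ⟨tens_le_Hrm (tens_le_Hrm Trl_le_Hrm le_rfl) Trl_le_Hrm h, ?_, ?_⟩
    · refine map_mem_of_mem_tens (S := ⊥) (ptraceLin (X × a) Y) (fun c _ d hd => ?_) h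
      change ptrace (c ⊗ₖ d) = 0
      rw [ptrace_kronecker, (mem_Trl.1 hd).2, zero_smul]
    · refine map_mem_of_mem_tens (S := ⊥) (trFirstLin X a Y) (fun c hc d _ => ?_) h
      refine map_mem_of_mem_tens (S := ⊥) ((trFirstLin X a Y).comp (kroneckerRightLin d))
        (fun c' hc' f _ => ?_) hc
      change trFirst ((c' ⊗ₖ f) ⊗ₖ d) = 0
      rw [trFirst_kronecker, (mem_Trl.1 hc').2, zero_smul]
  · rintro ⟨hK, h₁, h₂⟩
    have h := sub_ptrace_kronecker_mem_tens (N := K) (V := Hrm (X × a))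
      (by rw [tens_Hrm_Hrm]; exact hK)
    rw [h₁, Matrix.zero_kronecker, smul_zero, sub_zero, ← tens_Hrm_Hrm] at h
    -- The vanishing trace over `Y` has made the last factor traceless; subtracting `1_X / d_X ⊗
    -- Tr_X K`, which is zero by `h₂`, does the same for the first factor.
    have h' := map_mem_of_mem_tens (S := tens (tens (Trl X) (Hrm a)) (Trl Y))
      (LinearMap.id - (mixFirstLin X a Y).comp (trFirstLin X a Y)) (fun c hc d hd => ?_) h
    · have e : K - mixFirstLin X a Y (trFirst K) ∈ tens (tens (Trl X) (Hrm a)) (Trl Y) := h'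
      rwa [h₂, map_zero, sub_zero] at e
    · refine map_mem_of_mem_tens
        ((LinearMap.id - (mixFirstLin X a Y).comp (trFirstLin X a Y)).comp
          (kroneckerRightLin d)) (fun c' hc' f hf => ?_) hc
      change (c' ⊗ₖ f) ⊗ₖ d - mixFirstLin X a Y (trFirst ((c' ⊗ₖ f) ⊗ₖ d)) ∈ _
      rw [sub_mixFirst_kronecker]
      exact kronecker_mem_tens (kronecker_mem_tens (traceless_mem_Trl hc') hf) hd

theorem mem_bistochastic_iff [Fintype b] [DecidableEq b] [Nonempty b]
    [DecidableEq X] [Nonempty X] [DecidableEq Y] [Nonempty Y]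
    {N : Matrix (((X × a) × Y) × b) (((X × a) × Y) × b) ℂ} :
    N ∈ tens (Hrm ((X × a) × Y)) (Trl b) ⊔ tens (tens (tens (Trl X) (Hrm a)) (Trl Y)) (Idn b) ↔
      N.IsHermitian ∧ trOut N = 0 ∧ trFlip N = 0 := by
  rw [mem_tens_Trl_sup_tens_Idn_iff (tens_le_Hrm (tens_le_Hrm Trl_le_Hrm le_rfl) Trl_le_Hrm),
    mem_tens_Trl_Hrm_Trl_iff]
  -- By unfolding, `trOut` and `trFlip` are `ptrace` and `trFirst` applied to the partial trace over
  -- `b`.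
  exact ⟨fun h => ⟨h.1, h.2.2⟩, fun h => ⟨h.1, ptrace_isHermitian h.1, h.2⟩⟩

end Bistochastic

/-! ### Tracing out part of the output. -/

section PartialSum

variable {m n n' k : Type} [Fintype k]

/-- Tracing out the factor `k` of `n' ≃ n × k` commutes with the action on `m`. -/
theorem unchoi_partialSum [Fintype m] (e : n' ≃ n × k) (N : Matrix (m × n') (m × n') ℂ)
    (D : Matrix m m ℂ) :
    unchoi (Matrix.of fun p q : m × n => ∑ l, N (p.1, e.symm (p.2, l)) (q.1, e.symm (q.2, l))) D =
      ptrace (Matrix.reindex e e (unchoi N D)) := by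
  ext j j'
  simp only [unchoi_apply, ptrace_apply, Matrix.reindex_apply, Matrix.submatrix_apply,
    Matrix.of_apply, Finset.mul_sum]
  rw [Finset.sum_comm]
  rw [Finset.sum_congr rfl fun i _ => Finset.sum_comm, Finset.sum_comm]
  exact Finset.sum_congr rfl fun l _ => Finset.sum_comm

variable {X a Y : Type} [Fintype n] [Fintype n']

theorem trOut_partialSum [Fintype Y] (e : n' ≃ n × k)
    (N : Matrix (((X × a) × Y) × n') (((X × a) × Y) × n') ℂ) :
    trOut (Matrix.of fun p q : ((X × a) × Y) × n =>
      ∑ l, N (p.1, e.symm (p.2, l)) (q.1, e.symm (q.2, l))) = trOut N := by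
  ext p q
  simp only [trOut, Matrix.of_apply]
  refine Finset.sum_congr rfl fun j _ => ?_
  rw [← Equiv.sum_comp e.symm, Fintype.sum_prod_type]

theorem trFlip_partialSum [Fintype X] (e : n' ≃ n × k)
    (N : Matrix (((X × a) × Y) × n') (((X × a) × Y) × n') ℂ) :
    trFlip (Matrix.of fun p q : ((X × a) × Y) × n =>
      ∑ l, N (p.1, e.symm (p.2, l)) (q.1, e.symm (q.2, l))) = trFlip N := by
  ext p q
  simp only [trFlip, Matrix.of_apply]
  refine Finset.sum_congr rfl fun j _ => ?_
  rw [← Equiv.sum_comp e.symm, Fintype.sum_prod_type]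

end PartialSum

/-! ### Nonzero dimensions and the coefficients `λ_x`. -/

instance StrIdx.instNonempty : (w : List Sys) → Nonempty (StrIdx w)
  | [] => inferInstanceAs (Nonempty Unit)
  | A :: w =>
    haveI := StrIdx.instNonempty w
    haveI : Nonempty (Fin (A : ℕ)) := ⟨⟨0, A.pos⟩⟩
    inferInstanceAs (Nonempty (Fin (A : ℕ) × StrIdx w))

instance Sys.instNonempty (A : Sys) : Nonempty (Fin (A : ℕ)) := ⟨⟨0, A.pos⟩⟩

namespace Ty

instance Idx.instNonempty : (x : Ty) → Nonempty x.Idx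
  | sys w => inferInstanceAs (Nonempty (StrIdx w))
  | bist X u Y v =>
    inferInstanceAs (Nonempty (((Fin (X : ℕ) × StrIdx u) × Fin (Y : ℕ)) × StrIdx v))
  | arr x y =>
    haveI := Idx.instNonempty x
    haveI := Idx.instNonempty y
    inferInstanceAs (Nonempty (x.Idx × y.Idx))

theorem dim_pos (x : Ty) : 0 < x.dim := Fintype.card_pos

theorem lam_pos : (x : Ty) → 0 < x.lam
  | sys w => by
    have := dim_pos (sys w)
    simp only [lam]
    positivity
  | bist X u Y v => by
    have := dim_pos (sys v)
    have := Y.pos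
    simp only [lam]
    positivity
  | arr x y => by
    have := dim_pos x
    have := lam_pos x
    have := lam_pos y
    simp only [lam]
    positivity

theorem balanced_ext : {x : Ty} → (E : Sys) → x.Balanced → (x.ext E).Balanced
  | sys _, _, _ => trivial
  | bist _ _ _ _, _, h => h
  | arr _ _, E, h => ⟨h.1, balanced_ext E h.2⟩

theorem dim_sys_ext (w : List Sys) (E : Sys) :
    (sys (w ++ [E])).dim = (sys w).dim * (E : ℕ) := by
  have h : (sys (w ++ [E])).dim = Fintype.card (StrIdx w × Fin (E : ℕ)) :=
    Fintype.card_congr (StrIdx.snocEquiv E w)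
  rw [h, Fintype.card_prod, Fintype.card_fin]
  rfl

/-- The lost factor `d_E` is what tracing `E` out of the identity gives back, so the partial trace
takes `λ_{x∥E} 1` to `λ_x 1`. -/
theorem lam_ext (E : Sys) : (x : Ty) → (x.ext E).lam = x.lam / (E : ℕ)
  | sys w => by
    simp only [ext, lam, dim_sys_ext]
    push_cast
    rw [div_div]
  | bist X u Y v => by
    simp only [ext, lam, dim_sys_ext]
    push_cast
    rw [div_div, mul_assoc]
  | arr x y => by
    simp only [ext, lam, lam_ext E y]
    rw [div_right_comm]

/-! ### The subspaces `Δ_x` -/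

theorem mem_Delta_bist {X : Sys} {u : List Sys} {Y : Sys} {v : List Sys}
    {N : (bist X u Y v).Op} :
    N ∈ (bist X u Y v).Delta ↔ N.IsHermitian ∧
      trOut (X := Fin (X : ℕ)) (a := StrIdx u) (Y := Fin (Y : ℕ)) (b := StrIdx v) N = 0 ∧
      trFlip (X := Fin (X : ℕ)) (a := StrIdx u) (Y := Fin (Y : ℕ)) (b := StrIdx v) N = 0 :=
  mem_bistochastic_iff

theorem transpose_mem_Delta : (x : Ty) → ∀ a ∈ x.Delta, a.transpose ∈ x.Delta
  | sys w => fun _ ha => transpose_mem_Trl (m := StrIdx w) ha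
  | bist X u Y v => by
    intro a ha
    rw [mem_Delta_bist] at ha ⊢
    exact ⟨ha.1.transpose, congrArg Matrix.transpose ha.2.1, congrArg Matrix.transpose ha.2.2⟩
  | arr x y => by
    intro a ha
    refine transpose_mem_sup (m := x.Idx × y.Idx) (fun b hb => ?_) (fun b hb => ?_) ha
    · exact transpose_mem_tens (fun _ => transpose_mem_Hrm) (transpose_mem_Delta y) hb
    · refine transpose_mem_tens (fun c hc => ?_)
        (fun c hc => transpose_mem_perp (transpose_mem_Delta y) hc) hb
      exact ⟨transpose_mem_Trl hc.1, transpose_mem_perp (transpose_mem_Delta x) hc.2⟩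

theorem trace_unchoi_one {m n : Type} [Fintype m] [DecidableEq m] [Fintype n]
    (N : Matrix (m × n) (m × n) ℂ) : (unchoi N 1).trace = N.trace := by
  simp only [Matrix.trace, Matrix.diag_apply, unchoi_apply, Matrix.one_apply, ite_mul, one_mul,
    zero_mul, Finset.sum_ite_eq, Finset.mem_univ, if_true, Fintype.sum_prod_type]
  exact Finset.sum_comm

theorem trace_trOut {X a Y b : Type} [Fintype X] [Fintype a] [Fintype Y] [Fintype b]
    (N : Matrix (((X × a) × Y) × b) (((X × a) × Y) × b) ℂ) : (trOut N).trace = N.trace := by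
  change (ptrace (ptrace N)).trace = N.trace
  rw [trace_ptrace, trace_ptrace]

/-- For an arrow, the trace of `N` equals the trace of the image of `1`, which lies in `Δ_y` and is
traceless by induction. -/
theorem Delta_le_Trl : (x : Ty) → x.Delta ≤ Trl x.Idx
  | sys w => le_rfl
  | bist X u Y v => by
    intro N hN
    rw [mem_Delta_bist] at hN
    refine ⟨hN.1, ?_⟩
    have h := trace_trOut (X := Fin (X : ℕ)) (a := StrIdx u) (Y := Fin (Y : ℕ))
      (b := StrIdx v) N
    rw [hN.2.1, Matrix.trace_zero] at h
    exact h.symm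
  | arr x y => by
    intro N hN
    have h := (mem_tens_sup_tens_perpTrl_iff ((Delta_le_Trl x).trans Trl_le_Hrm)
      (transpose_mem_Delta x) ((Delta_le_Trl y).trans Trl_le_Hrm)).1 hN
    refine ⟨h.1, ?_⟩
    have h1 := trace_unchoi_one (m := x.Idx) (n := y.Idx) N
    rw [(mem_Trl.1 (Delta_le_Trl y h.2.1)).2] at h1
    exact h1.symm

theorem mem_Delta_arr {x y : Ty} {N : (arr x y).Op} :
    N ∈ (arr x y).Delta ↔ N.IsHermitian ∧ unchoi (m := x.Idx) (n := y.Idx) N 1 ∈ y.Delta ∧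
      ∀ D ∈ x.Delta, unchoi (m := x.Idx) (n := y.Idx) N D ∈ y.Delta :=
  mem_tens_sup_tens_perpTrl_iff ((Delta_le_Trl x).trans Trl_le_Hrm)
    (transpose_mem_Delta x) ((Delta_le_Trl y).trans Trl_le_Hrm)

theorem deltaDirect : (x : Ty) → x.DeltaDirect
  | sys _ => trivial
  | bist X u Y v =>
    disjoint_tens_of_disjoint_right (m := (Fin (X : ℕ) × StrIdx u) × Fin (Y : ℕ))
      (n := StrIdx v) le_rfl
      (tens_le_Hrm (tens_le_Hrm Trl_le_Hrm le_rfl) Trl_le_Hrm) disjoint_Trl_Idn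
  | arr x y =>
    disjoint_tens_of_disjoint_right (m := x.Idx) (n := y.Idx) le_rfl
      (inf_le_left.trans Trl_le_Hrm) (disjoint_perp _)

/-! ### Extension by a system -/

/-- The partial trace over the system `E` that extends the type `x`. -/
def trExt (E : Sys) {x : Ty} (S : (x.ext E).Op) : x.Op :=
  ptrace (Matrix.reindex (extEquiv E x) (extEquiv E x) S)

theorem trExt_apply (E : Sys) {x : Ty} (S : (x.ext E).Op) (i i' : x.Idx) :
    trExt E S i i' =
      ∑ k : Fin (E : ℕ), S ((extEquiv E x).symm (i, k)) ((extEquiv E x).symm (i', k)) := rfl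

theorem trExt_isHermitian {E : Sys} {x : Ty} {S : (x.ext E).Op} (hS : S.IsHermitian) :
    (trExt E S).IsHermitian :=
  ptrace_isHermitian (hS.submatrix _)

theorem trExt_sub (E : Sys) {x : Ty} (S T : (x.ext E).Op) :
    trExt E (S - T) = trExt E S - trExt E T := by
  ext i i'
  simp [trExt_apply]

theorem trExt_lam_smul_one (E : Sys) (x : Ty) :
    trExt E ((x.ext E).lam • (1 : (x.ext E).Op)) = x.lam • (1 : x.Op) := by
  have hE : ((E : ℕ) : ℂ) ≠ 0 := Nat.cast_ne_zero.2 E.ne_zero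
  ext i i'
  rw [trExt_apply, lam_ext]
  by_cases h : i = i'
  · subst h
    simp
    field_simp
  · simp [h]

theorem unchoi_trExt_mem_Delta {x y : Ty} (E : Sys) (N : ((arr x y).ext E).Op) (D : x.Op) :
    unchoi (m := x.Idx) (n := y.Idx) (trExt (x := arr x y) E N) D ∈ y.Delta ↔
      trExt E (unchoi (m := x.Idx) (n := (y.ext E).Idx) N D) ∈ y.Delta :=
  Iff.of_eq (congrArg (· ∈ y.Delta)
    (unchoi_partialSum (m := x.Idx) (n := y.Idx) (n' := (y.ext E).Idx) (extEquiv E y) N D))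

/-- In the ground types the constraints already trace over the system that is enlarged. For an arrow
only `y` is extended, and tracing out `E` commutes with applying the map to an operator on `x`. -/
theorem mem_Delta_ext (E : Sys) : {x : Ty} → {N : (x.ext E).Op} →
    (N ∈ (x.ext E).Delta ↔ N.IsHermitian ∧ trExt E N ∈ x.Delta)
  | sys w, N => by
    have h : (trExt (x := sys w) E N).trace = N.trace := by
      rw [trExt, trace_ptrace]
      exact Equiv.sum_comp (extEquiv E (sys w)).symm N.diag
    refine ⟨fun hN => ⟨hN.1, trExt_isHermitian hN.1, h.trans hN.2⟩,
      fun hN => ⟨hN.1, h.symm.trans hN.2.2⟩⟩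
  | bist X u Y v, N => by
    refine Iff.trans mem_Delta_bist (Iff.trans ?_ (and_congr_right fun _ => mem_Delta_bist.symm))
    have h₁ := trOut_partialSum (X := Fin (X : ℕ)) (a := StrIdx u) (Y := Fin (Y : ℕ))
      (StrIdx.snocEquiv E v) N
    have h₂ := trFlip_partialSum (X := Fin (X : ℕ)) (a := StrIdx u) (Y := Fin (Y : ℕ))
      (StrIdx.snocEquiv E v) N
    exact ⟨fun h => ⟨h.1, trExt_isHermitian h.1, h₁.trans h.2.1, h₂.trans h.2.2⟩,
      fun h => ⟨h.1, h₁.symm.trans h.2.2.1, h₂.symm.trans h.2.2.2⟩⟩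
  | arr x y, N => by
    refine Iff.trans mem_Delta_arr (Iff.trans ?_ (and_congr_right fun _ => mem_Delta_arr.symm))
    have key : N.IsHermitian → ∀ D : x.Op, D.IsHermitian →
        (unchoi (m := x.Idx) (n := (y.ext E).Idx) N D ∈ (y.ext E).Delta ↔
          unchoi (m := x.Idx) (n := y.Idx) (trExt (x := arr x y) E N) D ∈ y.Delta) :=
      fun hN D hD => (mem_Delta_ext E).trans (Iff.trans
        ⟨fun h => h.2, fun h => ⟨unchoi_isHermitian hN hD, h⟩⟩
        (unchoi_trExt_mem_Delta E N D).symm)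
    refine and_congr_right fun hN => ?_
    rw [key hN 1 Matrix.isHermitian_one]
    exact ⟨fun h => ⟨trExt_isHermitian hN, h.1,
        fun D hD => (key hN D (Delta_le_Trl x hD).1).1 (h.2 D hD)⟩,
      fun h => ⟨h.2.1, fun D hD => (key hN D (Delta_le_Trl x hD).1).2 (h.2.2 D hD)⟩⟩

end Ty

/-- Applying `𝓜 ⊗ 𝓘` to the unnormalized maximally entangled state returns the Choi operator. -/
theorem tensorId_unchoi_entangled {m n k : Type} [Fintype m] [DecidableEq k] (e : m ≃ k)
    (M : Matrix (m × n) (m × n) ℂ) (p q : m × n) :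
    tensorId k (unchoi M) (Matrix.vecMulVec
      (fun r : m × k => if e r.1 = r.2 then (1 : ℂ) else 0)
      (star fun r : m × k => if e r.1 = r.2 then (1 : ℂ) else 0)) (p.2, e p.1) (q.2, e q.1) =
    M p q := by
  classical
  change ∑ i, ∑ i', _ * M (i, p.2) (i', q.2) = M p q
  simp [Matrix.vecMulVec_apply, apply_ite star]

namespace Ty

/-! ### The affine spaces `λ_x 1 + Δ_x` -/

/-- The affine space `λ_x 1 + Δ_x`. -/
def aff (x : Ty) : Set x.Op := {R | R - x.lam • (1 : x.Op) ∈ x.Delta}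

theorem mem_aff {x : Ty} {R : x.Op} : R ∈ x.aff ↔ R - x.lam • (1 : x.Op) ∈ x.Delta := Iff.rfl

theorem mem_aff_iff_exists {x : Ty} {R : x.Op} :
    R ∈ x.aff ↔ ∃ X ∈ x.Delta, R = x.lam • (1 : x.Op) + X :=
  ⟨fun h => ⟨_, h, by abel⟩, by rintro ⟨X, hX, rfl⟩; simpa [mem_aff] using hX⟩

theorem lam_smul_one_mem_aff (x : Ty) : x.lam • (1 : x.Op) ∈ x.aff := by
  simp [mem_aff]

theorem lam_smul_one_posSemidef (x : Ty) : (x.lam • (1 : x.Op)).PosSemidef :=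
  Matrix.PosSemidef.one.smul (lam_pos x).le

theorem isHermitian_of_mem_Delta {x : Ty} {D : x.Op} (hD : D ∈ x.Delta) : D.IsHermitian :=
  (Delta_le_Trl x hD).1

theorem trace_of_mem_aff {x : Ty} {R : x.Op} (hR : R ∈ x.aff) :
    R.trace = ((x.lam * x.dim : ℝ) : ℂ) := by
  have h : (R - x.lam • (1 : x.Op)).trace = 0 := (Delta_le_Trl x hR).2
  rw [Matrix.trace_sub, sub_eq_zero] at h
  rw [h, Matrix.trace_smul, Matrix.trace_one, Complex.real_smul, dim]
  push_cast
  rfl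

theorem mem_aff_ext {E : Sys} {x : Ty} {S : (x.ext E).Op} (hS : S.IsHermitian) :
    S ∈ (x.ext E).aff ↔ trExt E S ∈ x.aff := by
  rw [mem_aff, mem_aff, mem_Delta_ext, trExt_sub, trExt_lam_smul_one]
  exact ⟨fun h => h.2, fun h => ⟨hS.sub (smul_one_mem_Hrm _), h⟩⟩

theorem unchoi_smul_one {x y : Ty} (c : ℝ) (O : x.Op) :
    unchoi (m := x.Idx) (n := y.Idx) (c • (1 : (arr x y).Op)) O = c • O.trace • (1 : y.Op) := by
  have h : unchoi ((1 : x.Op) ⊗ₖ (1 : y.Op)) O = O.trace • (1 : y.Op) := by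
    rw [unchoi_kronecker, mul_one, Matrix.trace_transpose]
  rw [Matrix.one_kronecker_one] at h
  exact (unchoi_real_smul c _ O).trans (congrArg (c • ·) h)

/-- This explains `λ_{x→y}`: elements of `λ_x 1 + Δ_x` have trace `λ_x d_x`, so the map with Choi
operator `λ_{x→y} 1` sends each of them to `λ_y 1`. -/
theorem unchoi_sub_lam_smul_one {x y : Ty} (R : (arr x y).Op) {O : x.Op} (hO : O ∈ x.aff) :
    unchoi (m := x.Idx) (n := y.Idx) (R - (arr x y).lam • (1 : (arr x y).Op)) O =
      unchoi (m := x.Idx) (n := y.Idx) R O - y.lam • (1 : y.Op) := by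
  have h : unchoi (m := x.Idx) (n := y.Idx) ((arr x y).lam • (1 : (arr x y).Op)) O =
      y.lam • (1 : y.Op) := by
    rw [unchoi_smul_one, trace_of_mem_aff hO, Complex.coe_smul, smul_smul]
    congr 1
    have h₁ := lam_pos x
    have h₂ : (0 : ℝ) < x.dim := Nat.cast_pos.2 (dim_pos x)
    rw [lam]
    field_simp
  rw [← h]
  exact (unchoiAt y.Idx O).map_sub R ((arr x y).lam • (1 : (arr x y).Op))

theorem mem_aff_arr {x y : Ty} {R : (arr x y).Op} (hR : R.IsHermitian) :
    R ∈ (arr x y).aff ↔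
      ∀ O ∈ x.aff, unchoi (m := x.Idx) (n := y.Idx) R O ∈ y.aff := by
  have hlam := lam_pos x
  set N : (arr x y).Op := R - (arr x y).lam • (1 : (arr x y).Op) with hN
  have hNH : N.IsHermitian := hR.sub (smul_one_mem_Hrm _)
  have key : ∀ O ∈ x.aff, (unchoi (m := x.Idx) (n := y.Idx) R O ∈ y.aff ↔
      unchoi (m := x.Idx) (n := y.Idx) N O ∈ y.Delta) := fun O hO => by
    rw [mem_aff, ← unchoi_sub_lam_smul_one R hO]
  have hsmul : unchoi (m := x.Idx) (n := y.Idx) N (x.lam • (1 : x.Op)) =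
      x.lam • unchoi (m := x.Idx) (n := y.Idx) N 1 := by
    rw [← Complex.coe_smul, map_smul, Complex.coe_smul]
  rw [mem_aff, mem_Delta_arr]
  constructor
  · rintro ⟨-, h1, h2⟩ O hO
    rw [key O hO, ← sub_add_cancel O (x.lam • (1 : x.Op)), map_add, hsmul]
    exact add_mem (h2 _ hO) (y.Delta.smul_mem _ h1)
  -- Evaluation at `λ_x 1` and at `λ_x 1 + D` recovers the two linear conditions.
  · intro h
    have h1 := (key _ (lam_smul_one_mem_aff x)).1 (h _ (lam_smul_one_mem_aff x))
    refine ⟨hNH, ?_, fun D hD => ?_⟩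
    · rw [hsmul] at h1
      exact (Submodule.smul_mem_iff _ hlam.ne').1 h1
    · have hO : x.lam • (1 : x.Op) + D ∈ x.aff := mem_aff_iff_exists.2 ⟨D, hD, rfl⟩
      have h2 := (key _ hO).1 (h _ hO)
      rw [map_add] at h2
      exact (Submodule.add_mem_iff_right _ h1).1 h2

/-- A linear map that sends the positive elements of `λ_x 1 + Δ_x` into `λ_y 1 + Δ_y` does so for
all elements. -/
theorem unchoi_mem_aff_of_posSemidef {x y : Ty} {M : (arr x y).Op}
    (h : ∀ O ∈ x.aff, O.PosSemidef → unchoi (m := x.Idx) (n := y.Idx) M O ∈ y.aff)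
    {O : x.Op} (hO : O ∈ x.aff) : unchoi (m := x.Idx) (n := y.Idx) M O ∈ y.aff := by
  obtain ⟨D, hD, rfl⟩ := mem_aff_iff_exists.1 hO
  -- For small `ε > 0` the point `λ_x 1 + ε D` is positive; comparing its image with that of `λ_x 1`
  -- puts the image of `D` in `Δ_y`.
  obtain ⟨ε, hε, hp⟩ := exists_pos_smul_one_sub_smul_posSemidef
    (mem_Hrm.2 (isHermitian_of_mem_Delta (x.Delta.neg_mem hD))) (lam_pos x)
  rw [smul_neg, sub_neg_eq_add] at hp
  have h0 := h _ (lam_smul_one_mem_aff x) (lam_smul_one_posSemidef x)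
  have h1 := h _ (mem_aff_iff_exists.2 ⟨_, x.Delta.smul_mem ε hD, rfl⟩) hp
  rw [mem_aff] at h0 h1 ⊢
  have h2 := y.Delta.sub_mem h1 h0
  rw [sub_sub_sub_cancel_right, map_add, add_sub_cancel_left, ← Complex.coe_smul, map_smul,
    Complex.coe_smul] at h2
  rw [map_add, add_sub_right_comm]
  exact add_mem h0 ((Submodule.smul_mem_iff _ hε.ne').1 h2)

/-! ### Extended maps -/

theorem trExt_extMap {x y : Ty} (M : (arr x y).Op) (E : Sys) (S : (x.ext E).Op) :
    trExt E (extMap M E S) = unchoi (m := x.Idx) (n := y.Idx) M (trExt E S) := by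
  rw [trExt, trExt, extMap, ← ptrace_tensorId]
  simp

theorem extMap_posSemidef {x y : Ty} {M : (arr x y).Op} (hM : M.PosSemidef) {E : Sys}
    {S : (x.ext E).Op} (hS : S.PosSemidef) : (extMap M E S).PosSemidef :=
  (tensorId_unchoi_posSemidef (m := x.Idx) (m' := y.Idx) hM (hS.submatrix _)).submatrix _

theorem extMap_apply {x y : Ty} (M : (arr x y).Op) (E : Sys) (S : (x.ext E).Op)
    (p q : (y.ext E).Idx) :
    extMap M E S p q = ∑ i : x.Idx, ∑ i' : x.Idx,
      S ((extEquiv E x).symm (i, (extEquiv E y p).2))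
          ((extEquiv E x).symm (i', (extEquiv E y q).2)) *
        M (i, (extEquiv E y p).1) (i', (extEquiv E y q).1) := rfl

theorem extMap_reindex_apply {x y : Ty} (M : (arr x y).Op) (E : Sys)
    (S : Matrix (x.Idx × Fin (E : ℕ)) (x.Idx × Fin (E : ℕ)) ℂ) (p q : y.Idx × Fin (E : ℕ)) :
    extMap M E (Matrix.reindex (extEquiv E x).symm (extEquiv E x).symm S)
        ((extEquiv E y).symm p) ((extEquiv E y).symm q) =
      tensorId (Fin (E : ℕ)) (unchoi (m := x.Idx) (n := y.Idx) M) S p q := by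
  simp [extMap]

theorem extMap_smul_right {x y : Ty} (M : (arr x y).Op) (E : Sys) (c : ℝ) (S : (x.ext E).Op) :
    extMap M E (c • S) = c • extMap M E S := by
  ext p q
  simp only [extMap_apply, Matrix.smul_apply, smul_mul_assoc, Finset.smul_sum]

theorem extMap_sub_right {x y : Ty} (M : (arr x y).Op) (E : Sys) (S T : (x.ext E).Op) :
    extMap M E (S - T) = extMap M E S - extMap M E T := by
  ext p q
  simp only [extMap_apply, Matrix.sub_apply, sub_mul, Finset.sum_sub_distrib]

theorem extMap_sub_left {x y : Ty} (M N : (arr x y).Op) (E : Sys) (S : (x.ext E).Op) :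
    extMap (M - N) E S = extMap M E S - extMap N E S := by
  ext p q
  rw [Matrix.sub_apply, extMap_apply, extMap_apply, extMap_apply, ← Finset.sum_sub_distrib]
  refine Finset.sum_congr rfl fun i _ => ?_
  rw [← Finset.sum_sub_distrib]
  exact Finset.sum_congr rfl fun i' _ => mul_sub _ _ _

/-! ### Deterministic and admissible events -/

theorem mem_det_arr {x y : Ty} {M : (arr x y).Op} :
    M ∈ (arr x y).det ↔ Preserves (fun E => (x.ext E).adm) (fun E => (y.ext E).adm) M ∧
      Preserves (fun E => (x.ext E).det) (fun E => (y.ext E).det) M := by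
  rw [det, events]
  rfl

theorem mem_adm_arr {x y : Ty} {M : (arr x y).Op} :
    M ∈ (arr x y).adm ↔ Preserves (fun E => (x.ext E).adm) (fun E => (y.ext E).adm) M ∧
      ∃ (n : ℕ) (N : Fin n → (arr x y).Op),
        (∀ i, Preserves (fun E => (x.ext E).adm) (fun E => (y.ext E).adm) (N i)) ∧
        M + ∑ i, N i ∈ (arr x y).det := by
  simp only [mem_det_arr]
  rw [adm, events]
  rfl

/-- The deterministic events of type `x` are the positive elements of `λ_x 1 + Δ_x`, and the
admissible events are the positive operators dominated by a deterministic one. -/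
def Characterized (x : Ty) : Prop :=
  (∀ R : x.Op, R ∈ x.det ↔ R.PosSemidef ∧ R ∈ x.aff) ∧ x.adm = below x.det

theorem characterized_sys (w : List Sys) : (sys w).Characterized := by
  refine ⟨fun R => ?_, by rw [adm, det, events]⟩
  have hd : (((sys w).dim : ℝ) : ℂ) ≠ 0 := by exact_mod_cast (dim_pos (sys w)).ne'
  have ht : (((sys w).lam • (1 : (sys w).Op)).trace : ℂ) = 1 := by
    rw [trace_of_mem_aff (lam_smul_one_mem_aff _), lam]
    push_cast at hd ⊢
    field_simp
  rw [det, events]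
  refine and_congr_right fun hR => ⟨fun h => ⟨hR.1.sub (smul_one_mem_Hrm _), ?_⟩, fun h => ?_⟩
  · change (R - (sys w).lam • (1 : (sys w).Op)).trace = 0
    rw [Matrix.trace_sub, ht, h, sub_self]
  · rw [trace_of_mem_aff h, ← trace_of_mem_aff (lam_smul_one_mem_aff _), ht]

theorem trOut_smul_one {X a Y b : Type} [DecidableEq X] [DecidableEq a] [Fintype Y]
    [DecidableEq Y] [Fintype b] [DecidableEq b] (c : ℝ)
    (R : Matrix (((X × a) × Y) × b) (((X × a) × Y) × b) ℂ) :
    trOut (R - c • 1) = trOut R - (c * (Fintype.card Y * Fintype.card b)) • 1 := by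
  ext p q
  by_cases h : p = q
  · subst h
    simp [trOut]
    ring
  · simp [trOut, h]

theorem trFlip_smul_one {X a Y b : Type} [Fintype X] [DecidableEq X] [DecidableEq a]
    [DecidableEq Y] [Fintype b] [DecidableEq b] (c : ℝ)
    (R : Matrix (((X × a) × Y) × b) (((X × a) × Y) × b) ℂ) :
    trFlip (R - c • 1) = trFlip R - (c * (Fintype.card X * Fintype.card b)) • 1 := by
  ext ⟨p₁, p₂⟩ ⟨q₁, q₂⟩
  by_cases h₁ : p₁ = q₁
  · by_cases h₂ : p₂ = q₂
    · subst h₁ h₂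
      simp [trFlip]
      ring
    · simp [trFlip, h₂]
  · simp [trFlip, h₁]

theorem characterized_bist {X : Sys} {u : List Sys} {Y : Sys} {v : List Sys}
    (h : (bist X u Y v).Balanced) : (bist X u Y v).Characterized := by
  refine ⟨fun R => ?_, by rw [adm, det, events]⟩
  have hXY : (X : ℕ) = (Y : ℕ) := h
  have hv : (0 : ℝ) < (sys v).dim := Nat.cast_pos.2 (dim_pos (sys v))
  have hY : (0 : ℝ) < (Y : ℕ) := Nat.cast_pos.2 Y.pos
  have hl : (bist X u Y v).lam * (((Y : ℕ) : ℝ) * (sys v).dim) = 1 := by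
    rw [lam]
    field_simp
  -- Equality of `d_X` and `d_Y` matters here: the single coefficient `1 / (d_Y d_v)` must also
  -- normalize the trace over `X` and `v`.
  have hl' : (bist X u Y v).lam * (((X : ℕ) : ℝ) * (sys v).dim) = 1 := by
    rw [lam, hXY]
    field_simp
  have h₁ := trOut_smul_one (X := Fin (X : ℕ)) (a := StrIdx u) (Y := Fin (Y : ℕ))
    (b := StrIdx v) (bist X u Y v).lam R
  have h₂ := trFlip_smul_one (X := Fin (X : ℕ)) (a := StrIdx u) (Y := Fin (Y : ℕ))
    (b := StrIdx v) (bist X u Y v).lam R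
  rw [Fintype.card_fin] at h₁ h₂
  have e₁ := h₁.trans (congrArg (fun c : ℝ => _ - c • _) hl)
  have e₂ := h₂.trans (congrArg (fun c : ℝ => _ - c • _) hl')
  rw [one_smul] at e₁ e₂
  rw [det, events]
  refine and_congr_right fun hR => ?_
  refine Iff.trans ?_ mem_Delta_bist.symm
  refine ⟨fun h => ⟨hR.1.sub (smul_one_mem_Hrm _), e₁.trans (sub_eq_zero.2 h.1),
    e₂.trans (sub_eq_zero.2 h.2)⟩, fun h => ⟨sub_eq_zero.1 (e₁.symm.trans h.2.1),
    sub_eq_zero.1 (e₂.symm.trans h.2.2)⟩⟩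

theorem Characterized.posSemidef_of_mem_adm {x : Ty} (hx : x.Characterized) {M : x.Op}
    (hM : M ∈ x.adm) : M.PosSemidef := by
  rw [hx.2] at hM
  exact hM.1

/-! ### The induction step for arrow types. -/

section Arrow

variable {x y : Ty}

theorem posSemidef_of_preserves_adm (hx : ∀ E, (x.ext E).Characterized)
    (hy : ∀ E, (y.ext E).Characterized)
    {M : (arr x y).Op}
    (hM : Preserves (fun E => (x.ext E).adm) (fun E => (y.ext E).adm) M) : M.PosSemidef := by
  -- A copy of the input space suffices: `S` is the unnormalized maximally entangled operator, whose
  -- image is `M` up to reindexing.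
  let E : Sys := ⟨x.dim, dim_pos x⟩
  let e : x.Idx ≃ Fin (E : ℕ) := Fintype.equivFin x.Idx
  let v : x.Idx × Fin (E : ℕ) → ℂ := fun r => if e r.1 = r.2 then 1 else 0
  let S : (x.ext E).Op :=
    Matrix.reindex (extEquiv E x).symm (extEquiv E x).symm (Matrix.vecMulVec v (star v))
  have hS : S.PosSemidef := (Matrix.posSemidef_vecMulVec_self_star v).submatrix _
  -- Scaling brings `ε S` below the deterministic event `λ 1`; the factor is undone after applying
  -- the map.
  obtain ⟨ε, hε, hp⟩ :=
    exists_pos_smul_one_sub_smul_posSemidef (mem_Hrm.2 hS.1) (lam_pos (x.ext E))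
  have hadm : ε • S ∈ (x.ext E).adm := by
    rw [(hx E).2]
    exact ⟨hS.smul hε.le, _, ((hx E).1 _).2
      ⟨lam_smul_one_posSemidef _, lam_smul_one_mem_aff _⟩, hp⟩
  have hpos := (((hy E).posSemidef_of_mem_adm (hM E _ hadm)).smul
    (inv_nonneg.2 hε.le)).submatrix
      (fun p : (arr x y).Idx => (extEquiv E y).symm (p.2, e p.1))
  refine Eq.subst (motive := Matrix.PosSemidef) ?_ hpos
  ext p q
  rw [extMap_smul_right, smul_smul, inv_mul_cancel₀ hε.ne', one_smul, Matrix.submatrix_apply,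
    extMap_reindex_apply]
  exact tensorId_unchoi_entangled (m := x.Idx) (n := y.Idx) e M p q

/-- If `S ≤ T` with `T` deterministic, then `𝓝(T) - 𝓜(S) = 𝓝(T - S) + (𝓝 - 𝓜)(S)`, and both terms
are positive by complete positivity. -/
theorem preserves_adm_of_le (hx : ∀ E, (x.ext E).Characterized)
    (hy : ∀ E, (y.ext E).Characterized)
    {M N : (arr x y).Op} (hM : M.PosSemidef) (hMN : (N - M).PosSemidef)
    (hN : Preserves (fun E => (x.ext E).det) (fun E => (y.ext E).det) N) :
    Preserves (fun E => (x.ext E).adm) (fun E => (y.ext E).adm) M := by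
  intro E S hS
  simp only [(hx E).2, (hy E).2] at hS ⊢
  obtain ⟨hS, T, hT, hTS⟩ := hS
  have hNp : N.PosSemidef := by simpa using hMN.add hM
  refine ⟨extMap_posSemidef hM hS, extMap N E T, hN E T hT, ?_⟩
  have h := (extMap_posSemidef hNp hTS).add (extMap_posSemidef hMN hS)
  rwa [extMap_sub_right, extMap_sub_left, sub_add_sub_cancel] at h

theorem mem_det_arr_iff_preserves (hx : ∀ E, (x.ext E).Characterized)
    (hy : ∀ E, (y.ext E).Characterized)
    {M : (arr x y).Op} :
    M ∈ (arr x y).det ↔ M.PosSemidef ∧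
      Preserves (fun E => (x.ext E).det) (fun E => (y.ext E).det) M := by
  rw [mem_det_arr]
  refine and_congr_left fun h => ⟨posSemidef_of_preserves_adm hx hy, fun hM => ?_⟩
  -- Taking `N = M` in the domination argument gives preservation of admissible events.
  exact preserves_adm_of_le hx hy hM (by rw [sub_self]; exact Matrix.PosSemidef.zero) h

theorem preserves_det_iff_mem_aff (hx : ∀ E, (x.ext E).Characterized)
    (hy : ∀ E, (y.ext E).Characterized)
    {M : (arr x y).Op} (hM : M.PosSemidef) :
    Preserves (fun E => (x.ext E).det) (fun E => (y.ext E).det) M ↔ M ∈ (arr x y).aff := by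
  rw [mem_aff_arr hM.1]
  constructor
  · intro h O hO
    refine unchoi_mem_aff_of_posSemidef (fun O hO hp => ?_) hO
    -- The hypotheses concern only extended types, so `O` is viewed as an event of `x ∥ I` with `I`
    -- trivial.
    let S : (x.ext 1).Op := Matrix.reindex (extEquiv 1 x).symm (extEquiv 1 x).symm
      (O ⊗ₖ (1 : Matrix (Fin ((1 : Sys) : ℕ)) (Fin ((1 : Sys) : ℕ)) ℂ))
    have hS : S.PosSemidef := (hp.kronecker Matrix.PosSemidef.one).submatrix _
    have hSO : trExt 1 S = O := by
      have h1 : trExt 1 S = ptrace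
          (O ⊗ₖ (1 : Matrix (Fin ((1 : Sys) : ℕ)) (Fin ((1 : Sys) : ℕ)) ℂ)) :=
        congrArg ptrace ((Matrix.reindex (extEquiv 1 x) (extEquiv 1 x)).apply_symm_apply _)
      have h2 : Fintype.card (Fin ((1 : Sys) : ℕ)) = 1 := Fintype.card_fin _
      rw [h1, ptrace_kronecker, Matrix.trace_one, h2, Nat.cast_one, one_smul]
    have hT := ((hy 1).1 _).1 (h 1 S (((hx 1).1 S).2
      ⟨hS, (mem_aff_ext hS.1).2 (by rwa [hSO])⟩))
    have h2 := (mem_aff_ext hT.1.1).1 hT.2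
    rwa [trExt_extMap, hSO] at h2
  · intro h E S hS
    obtain ⟨hS, hSa⟩ := ((hx E).1 S).1 hS
    have hp := extMap_posSemidef hM hS
    refine ((hy E).1 _).2 ⟨hp, (mem_aff_ext hp.1).2 ?_⟩
    rw [trExt_extMap]
    exact h _ ((mem_aff_ext hS.1).1 hSa)

theorem characterized_arr (hx : ∀ E, (x.ext E).Characterized)
    (hy : ∀ E, (y.ext E).Characterized) :
    (arr x y).Characterized := by
  refine ⟨fun R => ?_, Set.ext fun M => ?_⟩
  · rw [mem_det_arr_iff_preserves hx hy]
    exact and_congr_right (preserves_det_iff_mem_aff hx hy)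
  · rw [mem_adm_arr]
    constructor
    · rintro ⟨hM, n, N, hN, hd⟩
      refine ⟨posSemidef_of_preserves_adm hx hy hM, _, hd, ?_⟩
      rw [add_sub_cancel_left]
      exact Matrix.posSemidef_sum _ fun i _ => posSemidef_of_preserves_adm hx hy (hN i)
    · rintro ⟨hM, N, hN, hNM⟩
      have hNd := ((mem_det_arr_iff_preserves hx hy).1 hN).2
      -- One completing operator is enough, the difference `N - M`; it is again positive and
      -- dominated by `N`.
      refine ⟨preserves_adm_of_le hx hy hM hNM hNd, 1, fun _ => N - M, fun _ => ?_, ?_⟩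
      · exact preserves_adm_of_le hx hy hNM (by rwa [sub_sub_cancel]) hNd
      · rwa [Fin.sum_univ_one, add_sub_cancel]

end Arrow

/-- The types `x ∥ E` and `y ∥ E` are not subterms of `x → y`, so the recursion runs on the depth,
which extension preserves. -/
theorem characterized : (x : Ty) → x.Balanced → x.Characterized
  | sys w, _ => characterized_sys w
  | bist _ _ _ _, h => characterized_bist h
  | arr x y, h => characterized_arr
      (fun E => characterized (x.ext E) (balanced_ext E h.1))
      (fun E => characterized (y.ext E) (balanced_ext E h.2))
  termination_by x => x.depth
  decreasing_by all_goals simp only [depth_ext, depth]; omega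

end Ty

end HigherOrder

end

theorem mainTheorem1 (x : HigherOrder.Ty) (hx : x.Balanced) :
    0 < x.lam ∧ x.Delta ≤ HigherOrder.Trl x.Idx ∧ x.DeltaDirect ∧
      ∀ R : x.Op, R ∈ x.det ↔
        R.PosSemidef ∧ ∃ X ∈ x.Delta, R = x.lam • (1 : x.Op) + X := by
  refine ⟨x.lam_pos, x.Delta_le_Trl, x.deltaDirect, fun R => ?_⟩
  rw [(HigherOrder.Ty.characterized x hx).1, HigherOrder.Ty.mem_aff_iff_exists]
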